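/- Let $\Bbbk$ be a field, $\otimes=\otimes_{\Bbbk}$, and let $M(R)$ denote the multiplier algebra of an algebra $R$. Let $A$ and $Z$ be regular multiplier Hopf algebras over $\Bbbk$ (not necessarily unital), with coproducts $\Delta_A,\Delta_Z$ and counits $\varepsilon_A,\varepsilon_Z$. For a regular multiplier Hopf algebra $X$ and a linear map $\rho:X\to M(A\otimes X)$ with $\rho(X)(A\otimes 1)\subseteq A\otimes X$ and $(A\otimes 1)\rho(X)\subseteq A\otimes X$, put $T(x\otimes a)=\rho(x)(a\otimes 1)$, and consider the conditions (a) $((\imath\otimes T)(\Delta_X(x)\otimes a))(1\otimes1\otimes x')$ and $(1\otimes1\otimes x')((\imath\otimes T)(\Delta_X(x)\otimes a))$ belong to $X\otimes A\otimes X$ for all $x,x'\in X$, $a\in A$; (b) $(\imath\otimes\Delta_X)T(x\otimes a)=(T\otimes\imath)(\imath\otimes T)(\Delta_X(x)\otimes a)$ for all $x\in X$, $a\in A$. $X$ is a (left) $A$-comodule coalgebra via $\rho$ if $\rho$ is injective, $(\imath\otimes\rho)\rho=(\Delta_A\otimes\imath)\rho$, and (a), (b) hold. $X$ is a partial $A$-comodule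 coalgebra via $\rho$ if $(\varepsilon_A\otimes\imath)\rho(x)=x$ for all $x\in X$, (a), (b) hold, and $$(\imath\otimes T)(T\otimes\imath)(\imath\otimes\Delta_A)=((\imath\otimes\varepsilon_X)T\otimes\imath\otimes\imath)(\imath\otimes(\Delta_A\otimes\imath)T)(\Delta_X\otimes\imath),$$ where the last identity is understood after multiplication on the right by $1\otimes a'\otimes x'$, for all $a'\in A$, $x'\in X$. Let $Z$ be an $A$-comodule coalgebra via $\rho$, with $T(z\otimes a)=\rho(z)(a\otimes1)$. Let $Y\subseteq Z$ be a regular multiplier Hopf subalgebra, i.e. a subalgebra which is a regular multiplier Hopf algebra whose coproduct $\Delta_Y$ is the restriction of $\Delta_Z$, with counit $\varepsilon_Y$. Let $\pi:Z\to Z$ be an algebra projection over $Y$, i.e. a multiplicative linear map with image $Y$ and $\pi(y)=y$ for all $y\in Y$. Suppose that (i) $\pi$ is comultiplicative: $\Delta_Y(\pi(z))(1\otimes y)=(\pi\otimes\pi)(\Delta_Z(z)(1\otimes y))$ and $\Delta_Y(\pi(z))(y\otimes1)=(\pi\otimes\pi)(\Delta_Z(z)(y\otimes1))$ for all $z\in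 Z$, $y\in Y$; (ii) $(\imath_A\otimes\pi)T(\pi(z)\otimes a)=(\imath_A\otimes\pi)T(z\otimes a)$ for all $a\in A$, $z\in Z$; (iii) $(\imath_A\otimes\pi)T(\pi(z)\otimes a)=(\imath_A\otimes\pi)T(z_{(2)}\otimes a)\,\varepsilon_Y(\pi(z_{(1)}t))$ for all $a\in A$, $z\in Z$ and all $t\in Y$ with $\varepsilon_Y(t)=1$, where $z_{(1)}t\otimes z_{(2)}=\Delta_Z(z)(t\otimes1)$. Then there is a linear map $\beta=(\imath_A\otimes\pi)\rho:Y\to M(A\otimes Y)$ with $$\beta(y)(a\otimes1)=(\imath_A\otimes\pi)(\rho(y)(a\otimes1)),\qquad (a\otimes1)\beta(y)=(\imath_A\otimes\pi)((a\otimes1)\rho(y))$$ for all $y\in Y$, $a\in A$, and $Y$ is a partial $A$-comodule coalgebra via $\beta$. -/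

import Mathlib

open scoped TensorProduct

noncomputable section

/-- For `f : M ⊗ N → M' ⊗ N'`, the map `f ⊗ id : M ⊗ N ⊗ P → M' ⊗ N' ⊗ P`
(triple tensor products are bracketed to the right). -/
def onFirstTwo {k M N M' N' : Type*} [Field k] [AddCommGroup M] [Module k M]
    [AddCommGroup N] [Module k N] [AddCommGroup M'] [Module k M'] [AddCommGroup N'] [Module k N']
    (P : Type*) [AddCommGroup P] [Module k P] (f : M ⊗[k] N →ₗ[k] M' ⊗[k] N') :
    M ⊗[k] (N ⊗[k] P) →ₗ[k] M' ⊗[k] (N' ⊗[k] P) :=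
  (TensorProduct.assoc k M' N' P).toLinearMap ∘ₗ f.rTensor P ∘ₗ
    (TensorProduct.assoc k M N P).symm.toLinearMap

/-- A (possibly non-unital) algebra with nondegenerate product. -/
def IsNondegenerate (R : Type*) [NonUnitalRing R] : Prop :=
  (∀ a : R, (∀ b, a * b = 0) → a = 0) ∧ (∀ b : R, (∀ a, a * b = 0) → b = 0)

section Multipliers

variable (k R : Type*) [Field k] [NonUnitalRing R] [Module k R] [IsScalarTower k R R]
  [SMulCommClass k R R]

/-- The multiplier algebra `M(R)`: all pairs `(X, X')` of linear maps on `R` such that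
`a X(b) = X'(a) b`, with product `(X, X') (Y, Y') = (X ∘ Y, Y' ∘ X')` and unit `(id, id)`. -/
def multiplierAlgebra :
    Subalgebra k (Module.End k R × (Module.End k R)ᵐᵒᵖ) where
  carrier := {p | ∀ a b : R, a * p.1 b = p.2.unop a * b}
  mul_mem' := by
    intro p q hp hq a b
    have h1 := hp a (q.1 b)
    have h2 := hq (p.2.unop a) b
    simpa [h1] using h2
  add_mem' := by
    intro p q hp hq a b
    simp [mul_add, add_mul, hp a b, hq a b]
  algebraMap_mem' := by
    intro r a b
    simp [Algebra.algebraMap_eq_smul_one, mul_smul_comm, smul_mul_assoc]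

/-- Elements of `M(R)`. -/
abbrev Multiplier : Type _ := multiplierAlgebra k R

variable {k R}

/-- `m · x` for a multiplier `m` of `R` and `x ∈ R`. -/
def Multiplier.left (m : Multiplier k R) : R →ₗ[k] R := m.1.1

/-- `x · m` for a multiplier `m` of `R` and `x ∈ R`. -/
def Multiplier.right (m : Multiplier k R) : R →ₗ[k] R := m.1.2.unop

/-- The canonical map `R → M(R)`, `a ↦ (a · _, _ · a)`. -/
def Multiplier.ofElement : R →ₗ[k] Multiplier k R where
  toFun a := ⟨(LinearMap.mulLeft k a, MulOpposite.op (LinearMap.mulRight k a)),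
    fun b c => (mul_assoc b a c).symm⟩
  map_add' a b := by
    apply Subtype.ext
    refine Prod.ext ?_ (MulOpposite.unop_injective ?_)
    · ext c
      simp [add_mul]
    · ext c
      simp [mul_add]
  map_smul' r a := by
    apply Subtype.ext
    refine Prod.ext ?_ (MulOpposite.unop_injective ?_)
    · ext c
      simp [smul_mul_assoc]
    · ext c
      simp [mul_smul_comm]

/-- The multiplier `m ⊗ n` of `R ⊗ S`, for multipliers `m` of `R` and `n` of `S`. -/
def Multiplier.tmul {S : Type*} [NonUnitalRing S] [Module k S] [IsScalarTower k S S]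
    [SMulCommClass k S S] (m : Multiplier k R) (n : Multiplier k S) :
    Multiplier k (R ⊗[k] S) :=
  ⟨(TensorProduct.map m.left n.left, MulOpposite.op (TensorProduct.map m.right n.right)), by
    intro x y
    change x * TensorProduct.map m.left n.left y = TensorProduct.map m.right n.right x * y
    induction x using TensorProduct.induction_on with
    | zero => simp
    | add x₁ x₂ h₁ h₂ => rw [add_mul, h₁, h₂, map_add, add_mul]
    | tmul a b =>
      induction y using TensorProduct.induction_on with
      | zero => simp
      | add y₁ y₂ h₁ h₂ => rw [mul_add, map_add, mul_add, h₁, h₂]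
      | tmul c d =>
        have h₁ : a * m.left c = m.right a * c := m.2 a c
        have h₂ : b * n.left d = n.right b * d := n.2 b d
        simp [Algebra.TensorProduct.tmul_mul_tmul, h₁, h₂]⟩

/-- The multiplier `a ⊗ 1` of `R ⊗ S`. -/
def firstLeg (S : Type*) [NonUnitalRing S] [Module k S] [IsScalarTower k S S]
    [SMulCommClass k S S] (a : R) : Multiplier k (R ⊗[k] S) :=
  Multiplier.tmul (Multiplier.ofElement a) 1

/-- The multiplier `1 ⊗ b` of `S ⊗ R`. -/
def secondLeg (S : Type*) [NonUnitalRing S] [Module k S] [IsScalarTower k S S]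
    [SMulCommClass k S S] (b : R) : Multiplier k (S ⊗[k] R) :=
  Multiplier.tmul 1 (Multiplier.ofElement b)

end Multipliers

section Hopf

variable (k A : Type*) [Field k] [NonUnitalRing A] [Module k A] [IsScalarTower k A A]
  [SMulCommClass k A A]

/-- A multiplier bialgebra: a nondegenerate algebra with a nondegenerate homomorphism
`Δ : A → M(A ⊗ A)` such that `Δ(A)(1 ⊗ A)`, `Δ(A)(A ⊗ 1)`, `(A ⊗ 1)Δ(A)`, `(1 ⊗ A)Δ(A)` lie in
`A ⊗ A`, and which is coassociative. The four maps `ΔR₂`, `ΔR₁`, `ΔL₁`, `ΔL₂` are determined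
by `Δ`; they only record these four inclusions. -/
structure MultiplierBialgebra where
  /-- the coproduct -/
  Δ : A →ₙₐ[k] Multiplier k (A ⊗[k] A)
  nondegenerate : IsNondegenerate A
  span_left : Submodule.span k {z : A ⊗[k] A | ∃ a x, z = (Δ a).left x} = ⊤
  span_right : Submodule.span k {z : A ⊗[k] A | ∃ a x, z = (Δ a).right x} = ⊤
  /-- `a ⊗ b ↦ Δ(a)(1 ⊗ b)` -/
  ΔR₂ : A ⊗[k] A →ₗ[k] A ⊗[k] A
  /-- `a ⊗ b ↦ Δ(a)(b ⊗ 1)` -/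
  ΔR₁ : A ⊗[k] A →ₗ[k] A ⊗[k] A
  /-- `a ⊗ b ↦ (a ⊗ 1)Δ(b)` -/
  ΔL₁ : A ⊗[k] A →ₗ[k] A ⊗[k] A
  /-- `a ⊗ b ↦ (1 ⊗ a)Δ(b)` -/
  ΔL₂ : A ⊗[k] A →ₗ[k] A ⊗[k] A
  ΔR₂_spec : ∀ a b, Multiplier.ofElement (ΔR₂ (a ⊗ₜ b)) = Δ a * secondLeg A b
  ΔR₁_spec : ∀ a b, Multiplier.ofElement (ΔR₁ (a ⊗ₜ b)) = Δ a * firstLeg A b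
  ΔL₁_spec : ∀ a b, Multiplier.ofElement (ΔL₁ (a ⊗ₜ b)) = firstLeg A a * Δ b
  ΔL₂_spec : ∀ a b, Multiplier.ofElement (ΔL₂ (a ⊗ₜ b)) = secondLeg A a * Δ b
  /-- `(Δ ⊗ id)Δ = (id ⊗ Δ)Δ`, covered by `a ⊗ 1 ⊗ 1` on the left and `1 ⊗ 1 ⊗ c` on the right:
  `(a ⊗ 1 ⊗ 1)(Δ ⊗ id)(Δ(b)(1 ⊗ c)) = (id ⊗ Δ)((a ⊗ 1)Δ(b))(1 ⊗ 1 ⊗ c)`. -/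
  coassoc : ∀ a b c : A,
    onFirstTwo A ΔL₁ (a ⊗ₜ[k] ΔR₂ (b ⊗ₜ[k] c)) =
      ΔR₂.lTensor A (onFirstTwo A ΔL₁ (a ⊗ₜ[k] (b ⊗ₜ[k] c)))

/-- A multiplier Hopf algebra: `a ⊗ b ↦ Δ(a)(1 ⊗ b)` and `a ⊗ b ↦ (a ⊗ 1)Δ(b)` are bijective. -/
structure MultiplierHopfAlgebra extends MultiplierBialgebra k A where
  ΔR₂_bijective : Function.Bijective ΔR₂
  ΔL₁_bijective : Function.Bijective ΔL₁

/-- A regular multiplier Hopf algebra: the same holds for the coproduct followed by the flip,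
that is, `a ⊗ b ↦ Δ(a)(b ⊗ 1)` and `a ⊗ b ↦ (1 ⊗ a)Δ(b)` are bijective too. -/
structure RegularMultiplierHopfAlgebra extends MultiplierHopfAlgebra k A where
  ΔR₁_bijective : Function.Bijective ΔR₁
  ΔL₂_bijective : Function.Bijective ΔL₂

end Hopf

section Nondegeneracy

variable {k R S : Type*} [Field k] [NonUnitalRing R] [Module k R] [IsScalarTower k R R]
  [SMulCommClass k R R] [NonUnitalRing S] [Module k S] [IsScalarTower k S S] [SMulCommClass k S S]

theorem eq_zero_of_lTensor {V W N ι : Type*} [AddCommGroup V] [Module k V]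
    [AddCommGroup W] [Module k W] [AddCommGroup N] [Module k N] (f : ι → W →ₗ[k] N)
    (hf : ∀ w, (∀ i, f i w = 0) → w = 0) (y : V ⊗[k] W) (hy : ∀ i, (f i).lTensor V y = 0) :
    y = 0 := by
  classical
  let b := Module.Basis.ofVectorSpace k V
  have key : ∀ (i) (z : V ⊗[k] W) (v), TensorProduct.equivFinsuppOfBasisLeft b
      ((f i).lTensor V z) v = f i (TensorProduct.equivFinsuppOfBasisLeft b z v) := by
    intro i z v
    induction z using TensorProduct.induction_on with
    | zero => simp
    | add z₁ z₂ h₁ h₂ => simp [h₁, h₂]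
    | tmul v' w => simp [TensorProduct.equivFinsuppOfBasisLeft_apply_tmul]
  apply (TensorProduct.equivFinsuppOfBasisLeft b).injective
  ext v
  simp only [map_zero, Finsupp.coe_zero, Pi.zero_apply]
  apply hf
  intro i
  rw [← key, hy]
  simp

theorem eq_zero_of_rTensor {V W N ι : Type*} [AddCommGroup V] [Module k V]
    [AddCommGroup W] [Module k W] [AddCommGroup N] [Module k N] (f : ι → W →ₗ[k] N)
    (hf : ∀ w, (∀ i, f i w = 0) → w = 0) (y : W ⊗[k] V) (hy : ∀ i, (f i).rTensor V y = 0) :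
    y = 0 := by
  apply (TensorProduct.comm k W V).injective
  rw [map_zero]
  apply eq_zero_of_lTensor f hf
  intro i
  have : (f i).lTensor V (TensorProduct.comm k W V y)
      = TensorProduct.comm k N V ((f i).rTensor V y) := by
    induction y using TensorProduct.induction_on with
    | zero => simp
    | add z₁ z₂ h₁ h₂ =>
      simp [LinearMap.lTensor, LinearMap.rTensor, ← TensorProduct.map_comm]
    | tmul v' w => simp
  rw [this, hy]
  simp

theorem ofElement_injective_of_nondegenerate (hR : IsNondegenerate R) (hS : IsNondegenerate S) :
    Function.Injective (Multiplier.ofElement (k := k) (R := R ⊗[k] S)) := by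
  rw [injective_iff_map_eq_zero]
  intro x hx
  have h : ∀ y, x * y = 0 := fun y =>
    congrArg (fun m : Multiplier k (R ⊗[k] S) => m.left y) hx
  apply eq_zero_of_rTensor (fun a : R => LinearMap.mulRight k a) (fun w hw => hR.1 w hw)
  intro a
  apply eq_zero_of_lTensor (fun b : S => LinearMap.mulRight k b) (fun w hw => hS.1 w hw)
  intro b
  rw [← h (a ⊗ₜ b)]
  induction x using TensorProduct.induction_on with
  | zero => simp
  | add z₁ z₂ h₁ h₂ =>
    have e : ∀ z : R ⊗[k] S, LinearMap.lTensor R (LinearMap.mulRight k b)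
        (LinearMap.rTensor S (LinearMap.mulRight k a) z) = z * a ⊗ₜ b := by
      intro z
      induction z using TensorProduct.induction_on with
      | zero => simp
      | add z₁ z₂ h₁ h₂ => simp [h₁, h₂, add_mul]
      | tmul v w => simp
    exact e _
  | tmul v w => simp

end Nondegeneracy

section Counit

variable {k A : Type*} [Field k] [NonUnitalRing A] [Module k A] [IsScalarTower k A A]
  [SMulCommClass k A A]

/-- `ε : A → k` is a counit: `(ε ⊗ id)(Δ(a)(1 ⊗ b)) = ab` and `(id ⊗ ε)((a ⊗ 1)Δ(b)) = ab`. -/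
def MultiplierBialgebra.IsCounit (H : MultiplierBialgebra k A) (ε : A →ₗ[k] k) : Prop :=
  (∀ a b, TensorProduct.lid k A (ε.rTensor A (H.ΔR₂ (a ⊗ₜ b))) = a * b) ∧
    (∀ a b, TensorProduct.rid k A (ε.lTensor A (H.ΔL₁ (a ⊗ₜ b))) = a * b)

theorem MultiplierHopfAlgebra.exists_counit (H : MultiplierHopfAlgebra k A) :
    ∃ ε, H.IsCounit ε := by
  -- `(a ⊗ 1)(Δ(b)(1 ⊗ c)) = ((a ⊗ 1)Δ(b))(1 ⊗ c)`
  have hcov : ∀ a b c : A, (LinearMap.mulRight k c).lTensor A (H.ΔL₁ (a ⊗ₜ b)) =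
      (LinearMap.mulLeft k a).rTensor A (H.ΔR₂ (b ⊗ₜ c)) := by
    intro a b c
    apply ofElement_injective_of_nondegenerate H.nondegenerate H.nondegenerate
    have e₁ : ∀ x : A ⊗[k] A, Multiplier.ofElement ((LinearMap.mulRight k c).lTensor A x) =
        Multiplier.ofElement x * secondLeg A c := by
      intro x
      apply Subtype.ext
      refine Prod.ext ?_ (MulOpposite.unop_injective ?_)
      · induction x using TensorProduct.induction_on with
        | zero => simp
        | add x y hx hy => simp only [map_add, add_mul, Subalgebra.coe_add, Prod.fst_add, hx, hy]
        | tmul p q =>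
          ext u v
          simp [Multiplier.ofElement, secondLeg, Multiplier.tmul, Multiplier.left, mul_assoc]
      · induction x using TensorProduct.induction_on with
        | zero => simp
        | add x y hx hy =>
          simp only [map_add, add_mul, Subalgebra.coe_add, Prod.snd_add, MulOpposite.unop_add,
            hx, hy]
        | tmul p q =>
          ext u v
          simp [Multiplier.ofElement, secondLeg, Multiplier.tmul, Multiplier.right, mul_assoc]
    have e₂ : ∀ x : A ⊗[k] A, Multiplier.ofElement ((LinearMap.mulLeft k a).rTensor A x) =
        firstLeg A a * Multiplier.ofElement x := by
      intro x
      apply Subtype.ext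
      refine Prod.ext ?_ (MulOpposite.unop_injective ?_)
      · induction x using TensorProduct.induction_on with
        | zero => simp
        | add x y hx hy => simp only [map_add, mul_add, Subalgebra.coe_add, Prod.fst_add, hx, hy]
        | tmul p q =>
          ext u v
          simp [Multiplier.ofElement, firstLeg, Multiplier.tmul, Multiplier.left, mul_assoc]
      · induction x using TensorProduct.induction_on with
        | zero => simp
        | add x y hx hy =>
          simp only [map_add, mul_add, Subalgebra.coe_add, Prod.snd_add, MulOpposite.unop_add,
            hx, hy]
        | tmul p q =>
          ext u v
          simp [Multiplier.ofElement, firstLeg, Multiplier.tmul, Multiplier.right, mul_assoc]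
    rw [e₁, e₂, H.ΔL₁_spec, H.ΔR₂_spec, mul_assoc]
  let R := LinearEquiv.ofBijective H.ΔR₂ H.ΔR₂_bijective
  let L := LinearEquiv.ofBijective H.ΔL₁ H.ΔL₁_bijective
  let m : A ⊗[k] A →ₗ[k] A := LinearMap.mul' k A
  let m' : A ⊗[k] A →ₗ[k] A := m ∘ₗ R.symm.toLinearMap
  have hm' : ∀ x, m' (H.ΔR₂ x) = m x := fun x => congrArg m (R.symm_apply_apply x)
  have hm'' : m' ∘ₗ H.ΔR₂ = m := LinearMap.ext hm'
  -- `(id ⊗ m')((a ⊗ 1)Δ(b) ⊗ c) = ab ⊗ c`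
  have key : ∀ (a : A) (u : A ⊗[k] A),
      m'.lTensor A (onFirstTwo A H.ΔL₁ (a ⊗ₜ[k] u)) = (LinearMap.mulLeft k a).rTensor A u := by
    intro a u
    obtain ⟨u, rfl⟩ := H.ΔR₂_bijective.2 u
    induction u using TensorProduct.induction_on with
    | zero => simp
    | add x y hx hy => simp only [map_add, TensorProduct.tmul_add, hx, hy]
    | tmul b c =>
      rw [H.coassoc, ← LinearMap.comp_apply, ← LinearMap.lTensor_comp, hm'', ← hcov]
      simp only [onFirstTwo, LinearMap.comp_apply, LinearEquiv.coe_coe,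
        TensorProduct.assoc_symm_tmul, LinearMap.rTensor_tmul]
      generalize H.ΔL₁ (a ⊗ₜ b) = w
      induction w using TensorProduct.induction_on with
      | zero => simp
      | add x y hx hy => simp only [map_add, TensorProduct.add_tmul, hx, hy]
      | tmul p q => simp [m]
  have key' : ∀ (w : A ⊗[k] A) (c : A),
      m'.lTensor A (TensorProduct.assoc k A A A (H.ΔL₁ w ⊗ₜ c)) = m w ⊗ₜ c := by
    intro w c
    induction w using TensorProduct.induction_on with
    | zero => simp
    | add x y hx hy => simp only [map_add, TensorProduct.add_tmul, hx, hy]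
    | tmul a b => simpa [onFirstTwo, m] using key a (b ⊗ₜ c)
  have key'' : ∀ p q c : A, p ⊗ₜ[k] m' (q ⊗ₜ c) = m (L.symm (p ⊗ₜ q)) ⊗ₜ[k] c := by
    intro p q c
    have h := key' (L.symm (p ⊗ₜ q)) c
    rw [show H.ΔL₁ (L.symm (p ⊗ₜ q)) = p ⊗ₜ q from L.apply_symm_apply _] at h
    simpa using h
  by_cases hA : ∃ p : A, p ≠ 0
  swap
  · push Not at hA
    exact ⟨0, fun a b => (hA _).trans (hA _).symm, fun a b => (hA _).trans (hA _).symm⟩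
  obtain ⟨p, hp⟩ := hA
  obtain ⟨φ, hφ⟩ := Module.Projective.exists_dual_ne_zero k hp
  let ε : A →ₗ[k] k :=
    (φ p)⁻¹ • (φ ∘ₗ m ∘ₗ L.symm.toLinearMap ∘ₗ TensorProduct.mk k A A p)
  have hε : ∀ q c, m' (q ⊗ₜ c) = ε q • c := by
    intro q c
    have h := congrArg (fun z => TensorProduct.lid k A (φ.rTensor A z)) (key'' p q c)
    simp only [LinearMap.rTensor_tmul, TensorProduct.lid_tmul] at h
    simp only [ε, LinearMap.smul_apply, LinearMap.comp_apply, smul_eq_mul, mul_smul,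
      TensorProduct.mk_apply, LinearEquiv.coe_coe]
    rw [← h, inv_smul_smul₀ hφ]
  refine ⟨ε, fun a b => ?_, fun a b => ?_⟩
  · have h : ∀ x, TensorProduct.lid k A (ε.rTensor A x) = m' x := by
      intro x
      induction x using TensorProduct.induction_on with
      | zero => simp
      | add x y hx hy => simp only [map_add, hx, hy]
      | tmul q c => simp [hε]
    rw [h, hm']
    simp [m]
  · have h : ∀ x : A ⊗[k] A, TensorProduct.rid k A (ε.lTensor A x) ⊗ₜ[k] p =
        m'.lTensor A (TensorProduct.assoc k A A A (x ⊗ₜ p)) := by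
      intro x
      induction x using TensorProduct.induction_on with
      | zero => simp
      | add x y hx hy => simp only [map_add, TensorProduct.add_tmul, hx, hy]
      | tmul r q => simp [hε, TensorProduct.smul_tmul]
    have h' := (h (H.ΔL₁ (a ⊗ₜ b))).trans (key' (a ⊗ₜ b) p)
    have h'' := congrArg (fun z => TensorProduct.rid k A (φ.lTensor A z)) h'
    simp only [LinearMap.lTensor_tmul, TensorProduct.rid_tmul] at h''
    simpa [m] using smul_right_injective A hφ h''

/-- The counit of a multiplier Hopf algebra. -/
def MultiplierHopfAlgebra.counit (H : MultiplierHopfAlgebra k A) : A →ₗ[k] k :=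
  H.exists_counit.choose

end Counit

section Comodules

variable (k A Y : Type*) [Field k] [NonUnitalRing A] [Module k A] [IsScalarTower k A A]
  [SMulCommClass k A A] [NonUnitalRing Y] [Module k Y] [IsScalarTower k Y Y] [SMulCommClass k Y Y]

/-- A linear map `ρ : Y → M(A ⊗ Y)` such that `ρ(Y)(A ⊗ 1) ⊆ A ⊗ Y` and `(A ⊗ 1)ρ(Y) ⊆ A ⊗ Y`.
The maps `T` and `Tbar` are determined by `ρ`; they only record these two inclusions. -/
structure CoactionMap where
  ρ : Y →ₗ[k] Multiplier k (A ⊗[k] Y)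
  /-- `y ⊗ a ↦ ρ(y)(a ⊗ 1)` -/
  T : Y ⊗[k] A →ₗ[k] A ⊗[k] Y
  /-- `a ⊗ y ↦ (a ⊗ 1)ρ(y)` -/
  Tbar : A ⊗[k] Y →ₗ[k] A ⊗[k] Y
  T_spec : ∀ y a, Multiplier.ofElement (T (y ⊗ₜ a)) = ρ y * firstLeg Y a
  Tbar_spec : ∀ a y, Multiplier.ofElement (Tbar (a ⊗ₜ y)) = firstLeg Y a * ρ y

variable {k A Y}

/-- For fixed `a`, the map `y ↦ T(y ⊗ a) = ρ(y)(a ⊗ 1)`. -/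
def CoactionMap.Tat (C : CoactionMap k A Y) (a : A) : Y →ₗ[k] A ⊗[k] Y :=
  C.T ∘ₗ (TensorProduct.mk k Y A).flip a

/-- `Y` is a (global) left `A`-comodule via `ρ`: the map `ρ` is injective and
`(id ⊗ ρ)ρ = (Δ ⊗ id)ρ`. -/
structure IsLeftComodule (HA : RegularMultiplierHopfAlgebra k A) (C : CoactionMap k A Y) :
    Prop where
  injective : Function.Injective C.ρ
  /-- `(id ⊗ ρ)(ρ(y))` and `(Δ ⊗ id)(ρ(y))` agree when multiplied on the right by
  `Δ(a)(1 ⊗ b) ⊗ 1`; these elements span `A ⊗ A ⊗ 1`. Here `(id ⊗ ρ)(ρ(y))(c ⊗ d ⊗ 1)` is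
  `(id ⊗ ρ)(ρ(y)(c ⊗ 1))(1 ⊗ d ⊗ 1)`, and `(Δ ⊗ id)(ρ(y))(Δ(a)(1 ⊗ b) ⊗ 1)` is
  `(Δ ⊗ id)(ρ(y)(a ⊗ 1))(1 ⊗ b ⊗ 1)`. -/
  coassoc_right : ∀ (y : Y) (a b : A),
    C.T.lTensor A (onFirstTwo A C.T (y ⊗ₜ[k] HA.ΔR₂ (a ⊗ₜ[k] b))) =
      TensorProduct.assoc k A A Y
        ((HA.ΔR₂ ∘ₗ (TensorProduct.mk k A A).flip b).rTensor Y (C.T (y ⊗ₜ[k] a)))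
  /-- The same, multiplied on the left by `(1 ⊗ b)Δ(a) ⊗ 1`. -/
  coassoc_left : ∀ (y : Y) (a b : A),
    C.Tbar.lTensor A (TensorProduct.leftComm k A A Y
        ((C.Tbar.lTensor A (TensorProduct.leftComm k A A Y
          (TensorProduct.assoc k A A Y (HA.ΔL₂ (b ⊗ₜ[k] a) ⊗ₜ[k] y)))))) =
      TensorProduct.assoc k A A Y
        ((HA.ΔL₂ ∘ₗ TensorProduct.mk k A A b).rTensor Y (C.Tbar (a ⊗ₜ[k] y)))

/-- `x ∈ Y ⊗ A ⊗ Y` equals `((id ⊗ T)(Δ(y) ⊗ a))(1 ⊗ 1 ⊗ w)`. Here `(id ⊗ T)(Δ(y) ⊗ a)` is the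
multiplier on the first tensor factor with
`(id ⊗ T)(Δ(y) ⊗ a)(v ⊗ 1 ⊗ 1) = (id ⊗ T)(Δ(y)(v ⊗ 1) ⊗ a)` and
`(v ⊗ 1 ⊗ 1)(id ⊗ T)(Δ(y) ⊗ a) = (id ⊗ T)((v ⊗ 1)Δ(y) ⊗ a)`. -/
def IsRightCover (HY : RegularMultiplierHopfAlgebra k Y) (C : CoactionMap k A Y)
    (y : Y) (a : A) (w : Y) (x : Y ⊗[k] (A ⊗[k] Y)) : Prop :=
  ∀ v : Y,
    (LinearMap.mulRight k v).rTensor (A ⊗[k] Y) x =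
      ((LinearMap.mulRight k w).lTensor A).lTensor Y ((C.Tat a).lTensor Y (HY.ΔR₁ (y ⊗ₜ v))) ∧
    (LinearMap.mulLeft k v).rTensor (A ⊗[k] Y) x =
      ((LinearMap.mulRight k w).lTensor A).lTensor Y ((C.Tat a).lTensor Y (HY.ΔL₁ (v ⊗ₜ y)))

/-- `x ∈ Y ⊗ A ⊗ Y` equals `(1 ⊗ 1 ⊗ w)((id ⊗ T)(Δ(y) ⊗ a))`. -/
def IsLeftCover (HY : RegularMultiplierHopfAlgebra k Y) (C : CoactionMap k A Y)
    (y : Y) (a : A) (w : Y) (x : Y ⊗[k] (A ⊗[k] Y)) : Prop :=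
  ∀ v : Y,
    (LinearMap.mulRight k v).rTensor (A ⊗[k] Y) x =
      ((LinearMap.mulLeft k w).lTensor A).lTensor Y ((C.Tat a).lTensor Y (HY.ΔR₁ (y ⊗ₜ v))) ∧
    (LinearMap.mulLeft k v).rTensor (A ⊗[k] Y) x =
      ((LinearMap.mulLeft k w).lTensor A).lTensor Y ((C.Tat a).lTensor Y (HY.ΔL₁ (v ⊗ₜ y)))

/-- `((id ⊗ T)(Δ(y) ⊗ a))(1 ⊗ 1 ⊗ w)` and `(1 ⊗ 1 ⊗ w)((id ⊗ T)(Δ(y) ⊗ a))` belong to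
`Y ⊗ A ⊗ Y`. -/
def HasCovers (HY : RegularMultiplierHopfAlgebra k Y) (C : CoactionMap k A Y) : Prop :=
  ∀ (y : Y) (a : A) (w : Y), (∃ x, IsRightCover HY C y a w x) ∧ (∃ x, IsLeftCover HY C y a w x)

/-- `(id ⊗ Δ)T(y ⊗ a) = (T ⊗ id)(id ⊗ T)(Δ(y) ⊗ a)` as multipliers on the third tensor factor:
the two sides agree when multiplied by `1 ⊗ 1 ⊗ w` on the right, and on the left. By definition
`(T ⊗ id)(z)(1 ⊗ 1 ⊗ w) = (T ⊗ id)(z(1 ⊗ 1 ⊗ w))` for `z = (id ⊗ T)(Δ(y) ⊗ a)`, and similarly on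
the left. -/
def IsDeltaCompatible (HY : RegularMultiplierHopfAlgebra k Y) (C : CoactionMap k A Y) : Prop :=
  ∀ (y : Y) (a : A) (w : Y),
    (∀ x, IsRightCover HY C y a w x →
      (HY.ΔR₂ ∘ₗ (TensorProduct.mk k Y Y).flip w).lTensor A (C.T (y ⊗ₜ a)) =
        onFirstTwo Y C.T x) ∧
    (∀ x, IsLeftCover HY C y a w x →
      (HY.ΔL₂ ∘ₗ TensorProduct.mk k Y Y w).lTensor A (C.T (y ⊗ₜ a)) =
        onFirstTwo Y C.T x)

/-- `Y` is a (global) left `A`-comodule coalgebra via `ρ`. -/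
structure IsComoduleCoalgebra (HA : RegularMultiplierHopfAlgebra k A)
    (HY : RegularMultiplierHopfAlgebra k Y) (C : CoactionMap k A Y) : Prop where
  isLeftComodule : IsLeftComodule HA C
  hasCovers : HasCovers HY C
  isDeltaCompatible : IsDeltaCompatible HY C

/-- `Y` is a (left) partial `A`-comodule coalgebra via `ρ`. -/
structure IsPartialComoduleCoalgebra (HA : RegularMultiplierHopfAlgebra k A)
    (HY : RegularMultiplierHopfAlgebra k Y) (C : CoactionMap k A Y) : Prop where
  /-- `(ε ⊗ id)(ρ(y)) = y`, covered by `a ⊗ 1` on the right, -/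
  counit_right : ∀ (y : Y) (a : A),
    TensorProduct.lid k Y (HA.counit.rTensor Y (C.T (y ⊗ₜ a))) = HA.counit a • y
  /-- and on the left. -/
  counit_left : ∀ (y : Y) (a : A),
    TensorProduct.lid k Y (HA.counit.rTensor Y (C.Tbar (a ⊗ₜ y))) = HA.counit a • y
  hasCovers : HasCovers HY C
  isDeltaCompatible : IsDeltaCompatible HY C
  /-- `(id ⊗ T)(T ⊗ id)(y ⊗ Δ(a)) = ((id ⊗ ε)T ⊗ id ⊗ id)(id ⊗ (Δ ⊗ id)T)(Δ(y) ⊗ a)`, both sides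
  multiplied by `1 ⊗ c ⊗ w` on the right. The left side becomes
  `(id ⊗ T)((T ⊗ id)(y ⊗ Δ(a)(1 ⊗ c)))(1 ⊗ 1 ⊗ w)`; the right side becomes
  `((id ⊗ ε)T ⊗ id ⊗ id)((id ⊗ Δ ⊗ id)(x)(1 ⊗ 1 ⊗ c ⊗ 1))` with
  `x = ((id ⊗ T)(Δ(y) ⊗ a))(1 ⊗ 1 ⊗ w) ∈ Y ⊗ A ⊗ Y`. -/
  partial_coassoc : ∀ (y : Y) (a c : A) (w : Y) (x : Y ⊗[k] (A ⊗[k] Y)),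
    IsRightCover HY C y a w x →
      ((LinearMap.mulRight k w).lTensor A).lTensor A
        (C.T.lTensor A (onFirstTwo A C.T (y ⊗ₜ[k] HA.ΔR₂ (a ⊗ₜ[k] c)))) =
      ((TensorProduct.rid k A).toLinearMap ∘ₗ HY.counit.lTensor A ∘ₗ C.T).rTensor (A ⊗[k] Y)
        ((TensorProduct.assoc k Y A (A ⊗[k] Y)).symm
          (((TensorProduct.assoc k A A Y).toLinearMap ∘ₗ
            (HA.ΔR₂ ∘ₗ (TensorProduct.mk k A A).flip c).rTensor Y).lTensor Y x))

end Comodules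

section Projections

variable {k Z : Type*} [Field k] [NonUnitalRing Z] [Module k Z] [IsScalarTower k Z Z]
  [SMulCommClass k Z Z]

/-- The inclusion `Y → Z` of a subalgebra. -/
def inclusionMap (Y : NonUnitalSubalgebra k Z) : Y →ₗ[k] Z := Y.toSubmodule.subtype

/-- The subalgebra `Y` of `Z` with the coproduct `Δ_Y` is a multiplier Hopf subalgebra: `Δ_Y` is the
restriction of `Δ_Z`, that is, for `y ∈ Y` the multiplier `Δ_Z(y)` maps `Y ⊗ Y` to itself on either
side, and there it is `Δ_Y(y)`. -/
def IsMultiplierHopfSubalgebra (HZ : RegularMultiplierHopfAlgebra k Z)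
    (Y : NonUnitalSubalgebra k Z) (HY : RegularMultiplierHopfAlgebra k Y) : Prop :=
  ∀ (y : Y) (x : Y ⊗[k] Y),
    (HZ.Δ (y : Z)).left (TensorProduct.map (inclusionMap Y) (inclusionMap Y) x) =
      TensorProduct.map (inclusionMap Y) (inclusionMap Y) ((HY.Δ y).left x) ∧
    (HZ.Δ (y : Z)).right (TensorProduct.map (inclusionMap Y) (inclusionMap Y) x) =
      TensorProduct.map (inclusionMap Y) (inclusionMap Y) ((HY.Δ y).right x)

/-- An algebra projection of `Z` over `Y`: a multiplicative linear operator `π` on `Z` with image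
`Y` and `π(y) = y` for all `y ∈ Y`. -/
structure AlgebraProjection (Y : NonUnitalSubalgebra k Z) where
  π : Z →ₙₐ[k] Z
  range_eq : Set.range π = (Y : Set Z)
  apply_of_mem : ∀ y ∈ Y, π y = y

/-- The projection, regarded as a linear map `Z → Y`. -/
def AlgebraProjection.toSub {Y : NonUnitalSubalgebra k Z} (P : AlgebraProjection Y) :
    Z →ₗ[k] Y :=
  LinearMap.codRestrict Y.toSubmodule (P.π : Z →ₗ[k] Z) fun z => by
    have h : P.π z ∈ (Y : Set Z) := P.range_eq ▸ Set.mem_range_self z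
    exact h

/-- `Δ_Y π = (π ⊗ π)Δ_Z`, that is, `Δ_Y(π(z))(1 ⊗ y) = (π ⊗ π)(Δ_Z(z)(1 ⊗ y))` and
`Δ_Y(π(z))(y ⊗ 1) = (π ⊗ π)(Δ_Z(z)(y ⊗ 1))`. -/
def AlgebraProjection.IsComultiplicative {Y : NonUnitalSubalgebra k Z} (P : AlgebraProjection Y)
    (HZ : RegularMultiplierHopfAlgebra k Z) (HY : RegularMultiplierHopfAlgebra k Y) : Prop :=
  ∀ (z : Z) (y : Y),
    HY.ΔR₂ (P.toSub z ⊗ₜ y) = TensorProduct.map P.toSub P.toSub (HZ.ΔR₂ (z ⊗ₜ (y : Z))) ∧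
    HY.ΔR₁ (P.toSub z ⊗ₜ y) = TensorProduct.map P.toSub P.toSub (HZ.ΔR₁ (z ⊗ₜ (y : Z)))

end Projections

end

/-! Condition (ii) says that `π` intertwines the two coactions on all of `Z`: `β.T (π z ⊗ a) = (ι ⊗
π) T(z ⊗ a)`. Together with comultiplicativity of `π`, this makes (a) and (b) for `β` the images of
(a) and (b) for `ρ`: applying `π ⊗ ι ⊗ π` to a covered element of `Z ⊗ A ⊗ Z` gives a covered
element for `Y` (`isRightCover_map`, `isLeftCover_map`).

The counit identity for `β` is the image under `π` of the identity `(ε ⊗ ι)ρ(z) = z`. The latter is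
not part of the notion of comodule used here; it follows from coassociativity and injectivity of `ρ`
(`IsLeftComodule.counit_right`, `counit_left`).

For partial coassociativity, write `X(z ⊗ a) = ((ι ⊗ T)(Δ(z) ⊗ a))(1 ⊗ 1 ⊗ w)`. Two facts carry the
argument. In `Z` itself, `onFirstTwo_cover` lets `X` be moved past `T` and `Δ_A`. Since it is an
identity before the outer `T` has been applied, it requires `T` to be injective (`T_injective`):
both sides are compared after applying `ι ⊗ T ⊗ ι`, where they are two forms of `(Δ_A ⊗ Δ_Z)T`.
Formally the inverse of `T` is given by the inverse antipode, of which only the map `antipodeInvMul`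
is needed. Condition (iii), via `counit_cover`, says that `ε_Y π ⊗ ι ⊗ π` collapses `X` to `((ι ⊗
π)T)(1 ⊗ w)`. Hence the right-hand side of the partial identity is `ε_Y π ⊗ ι ⊗ π` applied in the
last three legs to `(ι ⊗ X)(T ⊗ ι)(y ⊗ Δ(a)(1 ⊗ c))`, and collapsing `X` leaves the left-hand side.
-/

/-! ### Multiplication of multipliers by `a ⊗ 1` and `1 ⊗ b`. -/

section MultiplierLegs

variable {k R S : Type*} [Field k] [NonUnitalRing R] [Module k R] [IsScalarTower k R R]
  [SMulCommClass k R R] [NonUnitalRing S] [Module k S] [IsScalarTower k S S] [SMulCommClass k S S]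

theorem Multiplier.ext_apply {m n : Multiplier k (R ⊗[k] S)}
    (hl : ∀ r s, m.1.1 (r ⊗ₜ s) = n.1.1 (r ⊗ₜ s))
    (hr : ∀ r s, m.1.2.unop (r ⊗ₜ s) = n.1.2.unop (r ⊗ₜ s)) : m = n :=
  Subtype.ext <| Prod.ext (TensorProduct.ext' hl)
    (MulOpposite.unop_injective (TensorProduct.ext' hr))

theorem ofElement_mul_firstLeg (x : R ⊗[k] S) (a : R) :
    Multiplier.ofElement x * firstLeg S a =
      Multiplier.ofElement ((LinearMap.mulRight k a).rTensor S x) := by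
  induction x using TensorProduct.induction_on with
  | zero => simp
  | add x y hx hy => simp only [map_add, add_mul, hx, hy]
  | tmul p q =>
    apply Multiplier.ext_apply <;> intro u v <;>
    simp [Multiplier.ofElement, firstLeg, Multiplier.tmul, Multiplier.left, Multiplier.right,
      mul_assoc]

theorem ofElement_mul_secondLeg (x : R ⊗[k] S) (b : S) :
    Multiplier.ofElement x * secondLeg R b =
      Multiplier.ofElement ((LinearMap.mulRight k b).lTensor R x) := by
  induction x using TensorProduct.induction_on with
  | zero => simp
  | add x y hx hy => simp only [map_add, add_mul, hx, hy]
  | tmul p q =>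
    apply Multiplier.ext_apply <;> intro u v <;>
    simp [Multiplier.ofElement, secondLeg, Multiplier.tmul, Multiplier.left, Multiplier.right,
      mul_assoc]

theorem firstLeg_mul_ofElement (x : R ⊗[k] S) (a : R) :
    firstLeg S a * Multiplier.ofElement x =
      Multiplier.ofElement ((LinearMap.mulLeft k a).rTensor S x) := by
  induction x using TensorProduct.induction_on with
  | zero => simp
  | add x y hx hy => simp only [map_add, mul_add, hx, hy]
  | tmul p q =>
    apply Multiplier.ext_apply <;> intro u v <;>
    simp [Multiplier.ofElement, firstLeg, Multiplier.tmul, Multiplier.left, Multiplier.right,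
      mul_assoc]

theorem secondLeg_mul_ofElement (x : R ⊗[k] S) (b : S) :
    secondLeg R b * Multiplier.ofElement x =
      Multiplier.ofElement ((LinearMap.mulLeft k b).lTensor R x) := by
  induction x using TensorProduct.induction_on with
  | zero => simp
  | add x y hx hy => simp only [map_add, mul_add, hx, hy]
  | tmul p q =>
    apply Multiplier.ext_apply <;> intro u v <;>
    simp [Multiplier.ofElement, secondLeg, Multiplier.tmul, Multiplier.left, Multiplier.right,
      mul_assoc]

theorem firstLeg_mul_firstLeg (a b : R) :
    firstLeg (k := k) S a * firstLeg S b = firstLeg S (a * b) := by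
  apply Multiplier.ext_apply <;> intro u v <;>
  simp [Multiplier.ofElement, firstLeg, Multiplier.tmul, Multiplier.left, Multiplier.right,
    mul_assoc]

theorem firstLeg_mul_secondLeg (a : R) (b : S) :
    firstLeg (k := k) S a * secondLeg R b = Multiplier.ofElement (a ⊗ₜ b) := by
  apply Multiplier.ext_apply <;> intro u v <;>
  simp [Multiplier.ofElement, firstLeg, secondLeg, Multiplier.tmul, Multiplier.left,
    Multiplier.right]

theorem secondLeg_mul_firstLeg (a : R) (b : S) :
    secondLeg (k := k) R b * firstLeg S a = Multiplier.ofElement (a ⊗ₜ b) := by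
  apply Multiplier.ext_apply <;> intro u v <;>
  simp [Multiplier.ofElement, firstLeg, secondLeg, Multiplier.tmul, Multiplier.left,
    Multiplier.right]

end MultiplierLegs

/-! ### Cancelling one tensor leg by nondegeneracy. -/

section Cancellation

variable {k R V : Type*} [Field k] [NonUnitalRing R] [Module k R] [AddCommGroup V] [Module k V]

theorem eq_of_rTensor_mulRight [IsScalarTower k R R] (hR : IsNondegenerate R)
    {x y : R ⊗[k] V}
    (h : ∀ r, (LinearMap.mulRight k r).rTensor V x = (LinearMap.mulRight k r).rTensor V y) :
    x = y := by
  rw [← sub_eq_zero]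
  exact eq_zero_of_rTensor (fun r : R => LinearMap.mulRight k r) hR.1 _
    fun r => by rw [map_sub, h, sub_self]

theorem eq_of_rTensor_mulLeft [SMulCommClass k R R] (hR : IsNondegenerate R)
    {x y : R ⊗[k] V}
    (h : ∀ r, (LinearMap.mulLeft k r).rTensor V x = (LinearMap.mulLeft k r).rTensor V y) :
    x = y := by
  rw [← sub_eq_zero]
  exact eq_zero_of_rTensor (fun r : R => LinearMap.mulLeft k r) hR.2 _
    fun r => by rw [map_sub, h, sub_self]

theorem eq_of_lTensor_mulRight [IsScalarTower k R R] (hR : IsNondegenerate R)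
    {x y : V ⊗[k] R}
    (h : ∀ r, (LinearMap.mulRight k r).lTensor V x = (LinearMap.mulRight k r).lTensor V y) :
    x = y := by
  rw [← sub_eq_zero]
  exact eq_zero_of_lTensor (fun r : R => LinearMap.mulRight k r) hR.1 _
    fun r => by rw [map_sub, h, sub_self]

theorem eq_of_lTensor_rTensor_mulRight {W : Type*} [AddCommGroup W] [Module k W]
    [IsScalarTower k R R]
    (hR : IsNondegenerate R) {x y : V ⊗[k] (R ⊗[k] W)}
    (h : ∀ r, ((LinearMap.mulRight k r).rTensor W).lTensor V x =
      ((LinearMap.mulRight k r).rTensor W).lTensor V y) : x = y := by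
  rw [← sub_eq_zero]
  exact eq_zero_of_lTensor (fun r : R => (LinearMap.mulRight k r).rTensor W)
    (eq_zero_of_rTensor (fun r : R => LinearMap.mulRight k r) hR.1) _
    fun r => by rw [map_sub, h, sub_self]

end Cancellation

/-! ### Multiplier Hopf algebras: covered coassociativity, counit, inverse antipode. -/

section Bialgebra

variable {k A : Type*} [Field k] [NonUnitalRing A] [Module k A] [IsScalarTower k A A]
  [SMulCommClass k A A]

namespace MultiplierBialgebra

theorem ofElement_injective (H : MultiplierBialgebra k A) :
    Function.Injective (Multiplier.ofElement (k := k) (R := A ⊗[k] A)) :=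
  ofElement_injective_of_nondegenerate H.nondegenerate H.nondegenerate

variable (H : MultiplierBialgebra k A)

theorem lTensor_mulRight_ΔR₁ (a b c : A) :
    (LinearMap.mulRight k c).lTensor A (H.ΔR₁ (a ⊗ₜ b)) =
      (LinearMap.mulRight k b).rTensor A (H.ΔR₂ (a ⊗ₜ c)) := by
  apply H.ofElement_injective
  rw [← ofElement_mul_secondLeg, ← ofElement_mul_firstLeg, H.ΔR₁_spec, H.ΔR₂_spec, mul_assoc,
    mul_assoc, firstLeg_mul_secondLeg, secondLeg_mul_firstLeg]

theorem rTensor_mulRight_ΔL₁ (a b c : A) :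
    (LinearMap.mulRight k c).rTensor A (H.ΔL₁ (a ⊗ₜ b)) =
      (LinearMap.mulLeft k a).rTensor A (H.ΔR₁ (b ⊗ₜ c)) := by
  apply H.ofElement_injective
  rw [← ofElement_mul_firstLeg, ← firstLeg_mul_ofElement, H.ΔL₁_spec, H.ΔR₁_spec, mul_assoc]

theorem lTensor_mulRight_ΔL₂ (a b c : A) :
    (LinearMap.mulRight k c).lTensor A (H.ΔL₂ (a ⊗ₜ b)) =
      (LinearMap.mulLeft k a).lTensor A (H.ΔR₂ (b ⊗ₜ c)) := by
  apply H.ofElement_injective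
  rw [← ofElement_mul_secondLeg, ← secondLeg_mul_ofElement, H.ΔL₂_spec, H.ΔR₂_spec, mul_assoc]

/-- `(id ⊗ Δ)(Δ(a)(b ⊗ 1))(1 ⊗ 1 ⊗ c) = (Δ ⊗ id)(Δ(a)(1 ⊗ c))(b ⊗ 1 ⊗ 1)`. -/
theorem coassoc_right (a b c : A) :
    (H.ΔR₂ ∘ₗ (TensorProduct.mk k A A).flip c).lTensor A (H.ΔR₁ (a ⊗ₜ b)) =
      TensorProduct.assoc k A A A
        ((H.ΔR₁ ∘ₗ (TensorProduct.mk k A A).flip b).rTensor A (H.ΔR₂ (a ⊗ₜ c))) := by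
  -- The axiom `coassoc` covers the first leg on the left. So cover by `d` on the left here, and by
  -- `b` on the right there; both sides then agree because `((d ⊗ 1)Δ(a))(b ⊗ 1) = (d ⊗ 1)(Δ(a)(b ⊗
  -- 1))`.
  apply eq_of_rTensor_mulLeft H.nondegenerate
  intro d
  have h := congrArg ((LinearMap.mulRight k b).rTensor (A ⊗[k] A)) (H.coassoc d a c)
  have e₁ : ∀ x : A ⊗[k] A, (LinearMap.mulLeft k d).rTensor (A ⊗[k] A)
      ((H.ΔR₂ ∘ₗ (TensorProduct.mk k A A).flip c).lTensor A x) =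
      (H.ΔR₂ ∘ₗ (TensorProduct.mk k A A).flip c).lTensor A
        ((LinearMap.mulLeft k d).rTensor A x) := fun x => by
    rw [← LinearMap.comp_apply, ← LinearMap.comp_apply, LinearMap.lTensor_comp_rTensor,
      LinearMap.rTensor_comp_lTensor]
  have e₂ : ∀ x : A ⊗[k] A, (H.ΔR₂ ∘ₗ (TensorProduct.mk k A A).flip c).lTensor A
      ((LinearMap.mulRight k b).rTensor A x) = (LinearMap.mulRight k b).rTensor (A ⊗[k] A)
        (H.ΔR₂.lTensor A (TensorProduct.assoc k A A A (x ⊗ₜ c))) := fun x => by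
    induction x using TensorProduct.induction_on with
    | zero => simp
    | add x y hx hy => simp only [map_add, TensorProduct.add_tmul, hx, hy]
    | tmul p q => simp
  have e₃ : ∀ x : A ⊗[k] A, (LinearMap.mulRight k b).rTensor (A ⊗[k] A)
      (onFirstTwo A H.ΔL₁ (d ⊗ₜ[k] x)) = (LinearMap.mulLeft k d).rTensor (A ⊗[k] A)
        (TensorProduct.assoc k A A A
          ((H.ΔR₁ ∘ₗ (TensorProduct.mk k A A).flip b).rTensor A x)) := fun x => by
    induction x using TensorProduct.induction_on with
    | zero => simp
    | add x y hx hy => simp only [map_add, TensorProduct.tmul_add, hx, hy]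
    | tmul p q =>
      have e₄ : ∀ (f : A →ₗ[k] A) (y : A ⊗[k] A), f.rTensor (A ⊗[k] A)
          (TensorProduct.assoc k A A A (y ⊗ₜ q)) =
          TensorProduct.assoc k A A A (f.rTensor A y ⊗ₜ q) := fun f y => by
        induction y using TensorProduct.induction_on with
        | zero => simp
        | add x y hx hy => simp only [map_add, TensorProduct.add_tmul, hx, hy]
        | tmul p q => simp
      simp [onFirstTwo, e₄, H.rTensor_mulRight_ΔL₁]
  rw [e₁, ← H.rTensor_mulRight_ΔL₁, e₂, ← e₃, h]
  simp [onFirstTwo]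

end MultiplierBialgebra

namespace MultiplierHopfAlgebra

variable (H : MultiplierHopfAlgebra k A)

theorem counit_ΔR₂ (a b : A) :
    TensorProduct.lid k A (H.counit.rTensor A (H.ΔR₂ (a ⊗ₜ b))) = a * b :=
  H.exists_counit.choose_spec.1 a b

/-- Elements `Δ(b)(1 ⊗ c)` exhaust `A ⊗ A`, so identities for `ε ⊗ id` need only be checked on them,
where the counit property and multiplicativity of `Δ` apply. -/
theorem counit_mul (a b : A) : H.counit (a * b) = H.counit a * H.counit b := by
  -- `(ε ⊗ id)(Δ(a) u) = a (ε ⊗ id)(u)`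
  have key : ∀ a (u : A ⊗[k] A), ∃ v, Multiplier.ofElement v = H.Δ a * Multiplier.ofElement u ∧
      TensorProduct.lid k A (H.counit.rTensor A v) =
        a * TensorProduct.lid k A (H.counit.rTensor A u) := by
    intro a u
    obtain ⟨u, rfl⟩ := H.ΔR₂_bijective.2 u
    induction u using TensorProduct.induction_on with
    | zero => exact ⟨0, by simp⟩
    | add x y hx hy =>
      obtain ⟨v, hv, hv'⟩ := hx
      obtain ⟨w, hw, hw'⟩ := hy
      exact ⟨v + w, by simp only [map_add, mul_add, hv, hw, hv', hw', and_self]⟩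
    | tmul b c =>
      refine ⟨H.ΔR₂ ((a * b) ⊗ₜ c), ?_, ?_⟩
      · rw [H.ΔR₂_spec, H.ΔR₂_spec, map_mul, mul_assoc]
      · rw [counit_ΔR₂, counit_ΔR₂, mul_assoc]
  -- For `u = Δ(a)(1 ⊗ c)`, the product `u(b ⊗ 1)` is also `Δ(a)(b ⊗ c)`, and `key` evaluates it to
  -- `ε(b)ac`.
  have key₂ : ∀ (u : A ⊗[k] A), TensorProduct.lid k A
      (H.counit.rTensor A ((LinearMap.mulRight k b).rTensor A u)) =
        H.counit b • TensorProduct.lid k A (H.counit.rTensor A u) := by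
    intro u
    obtain ⟨u, rfl⟩ := H.ΔR₂_bijective.2 u
    induction u using TensorProduct.induction_on with
    | zero => simp
    | add x y hx hy => simp only [map_add, smul_add, hx, hy]
    | tmul a c =>
      obtain ⟨v, hv, hv'⟩ := key a (b ⊗ₜ c)
      have : v = (LinearMap.mulRight k b).rTensor A (H.ΔR₂ (a ⊗ₜ c)) := by
        apply H.ofElement_injective
        rw [hv, ← ofElement_mul_firstLeg, H.ΔR₂_spec, mul_assoc, secondLeg_mul_firstLeg]
      rw [← this, hv', counit_ΔR₂]
      simp [mul_smul_comm]
  by_cases h : ∀ c : A, c = 0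
  · simp [h a, h b]
  push Not at h
  obtain ⟨c, hc⟩ := h
  have := key₂ (a ⊗ₜ c)
  simp only [LinearMap.rTensor_tmul, LinearMap.mulRight_apply, TensorProduct.lid_tmul,
    smul_smul] at this
  rw [smul_left_injective k hc this, mul_comm]

/-- If `ε` vanished, then `ab = (ε ⊗ id)(Δ(a)(1 ⊗ b))` would be zero for all `a`, `b`, against
nondegeneracy. -/
theorem exists_counit_eq_one [Nontrivial A] : ∃ a, H.counit a = 1 := by
  by_contra! h
  have h0 : ∀ a, H.counit a = 0 := by
    intro a
    by_contra ha
    exact h ((H.counit a)⁻¹ • a) (by simp [ha])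
  have h1 : H.counit = 0 := LinearMap.ext h0
  obtain ⟨a, ha⟩ := exists_ne (0 : A)
  exact ha (H.nondegenerate.1 a fun b => by rw [← counit_ΔR₂ H, h1]; simp)

end MultiplierHopfAlgebra

namespace RegularMultiplierHopfAlgebra

variable (H : RegularMultiplierHopfAlgebra k A)

/-- The linear equivalence `a ⊗ b ↦ Δ(a)(b ⊗ 1)`. -/
noncomputable def ΔR₁Equiv : A ⊗[k] A ≃ₗ[k] A ⊗[k] A :=
  LinearEquiv.ofBijective H.ΔR₁ H.ΔR₁_bijective

/-- With `S` the antipode, the map `a ⊗ c ↦ S⁻¹(c) a`. -/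
noncomputable def antipodeInvMul : A ⊗[k] A →ₗ[k] A :=
  (TensorProduct.lid k A).toLinearMap ∘ₗ H.counit.rTensor A ∘ₗ H.ΔR₁Equiv.symm.toLinearMap

theorem antipodeInvMul_ΔR₁ (x : A ⊗[k] A) :
    H.antipodeInvMul (H.ΔR₁ x) = TensorProduct.lid k A (H.counit.rTensor A x) :=
  congrArg (fun y => TensorProduct.lid k A (H.counit.rTensor A y)) (H.ΔR₁Equiv.symm_apply_apply x)

/-- This is cancellation of `S⁻¹(c)a = 0`, obtained without constructing `S`: the inverse of `ΔR₁`
is recovered, up to a covering, from `antipodeInvMul` and `Δ`, so the preimage of `a ⊗ a` must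
vanish. -/
theorem eq_zero_of_antipodeInvMul (a : A) (h : ∀ c, H.antipodeInvMul (a ⊗ₜ c) = 0) : a = 0 := by
  -- On `v = q ⊗ r`, coassociativity exposes `Δ(q₍₁₎)(r ⊗ 1) ⊗ q₍₂₎e`; `antipodeInvMul` collapses
  -- the first part to `ε(q₍₁₎)r`, leaving `r ⊗ qe`.
  have key : ∀ (e : A) (v : A ⊗[k] A), H.antipodeInvMul.rTensor A
      ((TensorProduct.assoc k A A A).symm
        ((H.ΔR₂ ∘ₗ (TensorProduct.mk k A A).flip e).lTensor A (H.ΔR₁ v))) =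
      TensorProduct.comm k A A ((LinearMap.mulRight k e).rTensor A v) := by
    intro e v
    induction v using TensorProduct.induction_on with
    | zero => simp
    | add x y hx hy => simp only [map_add, hx, hy]
    | tmul q r =>
      rw [H.coassoc_right, LinearEquiv.symm_apply_apply]
      have : ∀ x : A ⊗[k] A, H.antipodeInvMul.rTensor A
          ((H.ΔR₁ ∘ₗ (TensorProduct.mk k A A).flip r).rTensor A x) =
          r ⊗ₜ TensorProduct.lid k A (H.counit.rTensor A x) := fun x => by
        induction x using TensorProduct.induction_on with
        | zero => simp
        | add x y hx hy => simp only [map_add, TensorProduct.tmul_add, hx, hy]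
        | tmul p q => simp [antipodeInvMul_ΔR₁, TensorProduct.smul_tmul]
      rw [this, H.counit_ΔR₂]
      simp
  have hv : H.ΔR₁Equiv.symm (a ⊗ₜ a) = 0 := by
    apply eq_of_rTensor_mulRight H.nondegenerate
    intro e
    apply (TensorProduct.comm k A A).injective
    rw [← key, show H.ΔR₁ (H.ΔR₁Equiv.symm (a ⊗ₜ a)) = a ⊗ₜ a from
      H.ΔR₁Equiv.apply_symm_apply _, LinearMap.lTensor_tmul]
    generalize (H.ΔR₂ ∘ₗ (TensorProduct.mk k A A).flip e) a = u
    simp only [map_zero]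
    induction u using TensorProduct.induction_on with
    | zero => simp
    | add x y hx hy => simp only [map_add, TensorProduct.tmul_add, hx, hy, add_zero]
    | tmul p q => simp [h]
  rw [LinearEquiv.map_eq_zero_iff] at hv
  by_contra ha
  obtain ⟨φ, hφ⟩ := Module.Projective.exists_dual_ne_zero k ha
  have := congrArg (fun x => TensorProduct.lid k k (TensorProduct.map φ φ x)) hv
  simp [hφ] at this

end RegularMultiplierHopfAlgebra

end Bialgebra

/-! ### Comodules: the counit identity and injectivity of `T`. -/

section Coactions

variable {k A Y : Type*} [Field k] [NonUnitalRing A] [Module k A] [IsScalarTower k A A]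
  [SMulCommClass k A A] [NonUnitalRing Y] [Module k Y] [IsScalarTower k Y Y] [SMulCommClass k Y Y]

theorem onFirstTwo_tmul {M N M' N' P : Type*} [AddCommGroup M] [Module k M]
    [AddCommGroup N] [Module k N] [AddCommGroup M'] [Module k M'] [AddCommGroup N'] [Module k N']
    [AddCommGroup P] [Module k P] (f : M ⊗[k] N →ₗ[k] M' ⊗[k] N') (m : M) (n : N) (p : P) :
    onFirstTwo P f (m ⊗ₜ (n ⊗ₜ p)) = TensorProduct.assoc k M' N' P (f (m ⊗ₜ n) ⊗ₜ p) := by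
  simp [onFirstTwo]

theorem onFirstTwo_assoc_tmul {M N M' N' P : Type*} [AddCommGroup M] [Module k M]
    [AddCommGroup N] [Module k N] [AddCommGroup M'] [Module k M'] [AddCommGroup N'] [Module k N']
    [AddCommGroup P] [Module k P] (f : M ⊗[k] N →ₗ[k] M' ⊗[k] N') (x : M ⊗[k] N) (p : P) :
    onFirstTwo P f (TensorProduct.assoc k M N P (x ⊗ₜ p)) =
      TensorProduct.assoc k M' N' P (f x ⊗ₜ p) := by
  simp [onFirstTwo]

namespace CoactionMap

variable (C : CoactionMap k A Y)

theorem T_tmul_mul (hA : IsNondegenerate A) (hY : IsNondegenerate Y)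
    (y : Y) (a b : A) :
    C.T (y ⊗ₜ (a * b)) = (LinearMap.mulRight k b).rTensor Y (C.T (y ⊗ₜ a)) := by
  apply ofElement_injective_of_nondegenerate hA hY
  rw [← ofElement_mul_firstLeg, C.T_spec, C.T_spec, mul_assoc, firstLeg_mul_firstLeg]

theorem Tbar_mul_tmul (hA : IsNondegenerate A) (hY : IsNondegenerate Y)
    (y : Y) (a b : A) :
    C.Tbar ((a * b) ⊗ₜ y) = (LinearMap.mulLeft k a).rTensor Y (C.Tbar (b ⊗ₜ y)) := by
  apply ofElement_injective_of_nondegenerate hA hY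
  rw [← firstLeg_mul_ofElement, C.Tbar_spec, C.Tbar_spec, ← mul_assoc, firstLeg_mul_firstLeg]

theorem rTensor_mulRight_Tbar (hA : IsNondegenerate A) (hY : IsNondegenerate Y)
    (y : Y) (a b : A) :
    (LinearMap.mulRight k b).rTensor Y (C.Tbar (a ⊗ₜ y)) =
      (LinearMap.mulLeft k a).rTensor Y (C.T (y ⊗ₜ b)) := by
  apply ofElement_injective_of_nondegenerate hA hY
  rw [← firstLeg_mul_ofElement, ← ofElement_mul_firstLeg, C.Tbar_spec, C.T_spec, mul_assoc]

/-- Vanishing of `ρ(y)(a ⊗ 1)` for all `a` forces that of `(a ⊗ 1)ρ(y)`. The latter kills the left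
action of the multiplier `ρ(y)`, the former its right action. -/
theorem eq_zero_of_T_eq_zero (hA : IsNondegenerate A) (hY : IsNondegenerate Y)
    (hC : Function.Injective C.ρ) (y : Y) (h : ∀ a, C.T (y ⊗ₜ a) = 0) :
    y = 0 := by
  have hbar : ∀ a, C.Tbar (a ⊗ₜ y) = 0 := fun a => by
    apply eq_of_rTensor_mulRight hA
    intro b
    rw [C.rTensor_mulRight_Tbar hA hY, h, map_zero, map_zero]
  apply hC
  rw [map_zero]
  refine Subtype.ext (Prod.ext (LinearMap.ext fun x => ?_)
    (MulOpposite.unop_injective (LinearMap.ext fun x => ?_)))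
  · apply eq_of_rTensor_mulLeft hA
    intro a
    have := congrArg (fun m : Multiplier k (A ⊗[k] Y) => m.1.1 x) (C.Tbar_spec a y)
    rw [hbar a, map_zero] at this
    exact this.symm.trans (map_zero ((LinearMap.mulLeft k a).rTensor Y)).symm
  · apply eq_of_rTensor_mulRight hA
    intro a
    have := congrArg (fun m : Multiplier k (A ⊗[k] Y) => m.1.2.unop x) (C.T_spec y a)
    rw [h a, map_zero] at this
    exact this.symm.trans (map_zero ((LinearMap.mulRight k a).rTensor Y)).symm

end CoactionMap

namespace IsLeftComodule

variable {HA : RegularMultiplierHopfAlgebra k A} {C : CoactionMap k A Y}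

/-- Applying `ε` to the first leg of coassociativity gives `T((ε ⊗ ι)T(y ⊗ a) ⊗ b) = ε(a) T(y ⊗ b)`
for all `b`, and injectivity of `ρ` removes the outer `T`. -/
theorem counit_right (hC : IsLeftComodule HA C) (hY : IsNondegenerate Y) (y : Y) (a : A) :
    TensorProduct.lid k Y (HA.counit.rTensor Y (C.T (y ⊗ₜ a))) = HA.counit a • y := by
  have e₁ : ∀ (b : A) (x : A ⊗[k] Y), TensorProduct.lid k (A ⊗[k] Y) (HA.counit.rTensor (A ⊗[k] Y)
      (TensorProduct.assoc k A A Y ((HA.ΔR₂ ∘ₗ (TensorProduct.mk k A A).flip b).rTensor Y x))) =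
      (LinearMap.mulRight k b).rTensor Y x := fun b x => by
    induction x using TensorProduct.induction_on with
    | zero => simp
    | add x y hx hy => simp only [map_add, hx, hy]
    | tmul p q =>
      have e : ∀ u : A ⊗[k] A, TensorProduct.lid k (A ⊗[k] Y) (HA.counit.rTensor (A ⊗[k] Y)
          (TensorProduct.assoc k A A Y (u ⊗ₜ q))) =
          TensorProduct.lid k A (HA.counit.rTensor A u) ⊗ₜ q := fun u => by
        induction u using TensorProduct.induction_on with
        | zero => simp
        | add x y hx hy => simp only [map_add, TensorProduct.add_tmul, hx, hy]
        | tmul r s => simp [TensorProduct.smul_tmul']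
      simp [e, HA.counit_ΔR₂]
  have e₂ : ∀ (x : A ⊗[k] (Y ⊗[k] A)), TensorProduct.lid k (A ⊗[k] Y)
      (HA.counit.rTensor (A ⊗[k] Y) (C.T.lTensor A x)) =
      C.T (TensorProduct.lid k (Y ⊗[k] A) (HA.counit.rTensor (Y ⊗[k] A) x)) := fun x => by
    induction x using TensorProduct.induction_on with
    | zero => simp
    | add x y hx hy => simp only [map_add, hx, hy]
    | tmul p q => simp
  have e₃ : ∀ (z : Y) (u : A ⊗[k] A),
      C.T (TensorProduct.lid k (Y ⊗[k] A) (HA.counit.rTensor (Y ⊗[k] A)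
        (onFirstTwo A C.T (z ⊗ₜ u)))) =
      C.T (z ⊗ₜ TensorProduct.lid k A (HA.counit.rTensor A u)) := fun z u => by
    obtain ⟨u, rfl⟩ := HA.ΔR₂_bijective.2 u
    induction u using TensorProduct.induction_on with
    | zero => simp
    | add x y hx hy => simp only [map_add, TensorProduct.tmul_add, hx, hy]
    | tmul p q =>
      rw [← e₂, hC.coassoc_right, e₁, HA.counit_ΔR₂, C.T_tmul_mul HA.nondegenerate hY]
  rw [← sub_eq_zero]
  apply C.eq_zero_of_T_eq_zero HA.nondegenerate hY hC.injective
  intro b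
  have h := e₃ y (a ⊗ₜ b)
  have e₄ : ∀ x : A ⊗[k] Y, TensorProduct.lid k (Y ⊗[k] A) (HA.counit.rTensor (Y ⊗[k] A)
      (TensorProduct.assoc k A Y A (x ⊗ₜ b))) =
      TensorProduct.lid k Y (HA.counit.rTensor Y x) ⊗ₜ b := fun x => by
    induction x using TensorProduct.induction_on with
    | zero => simp
    | add x y hx hy => simp only [map_add, TensorProduct.add_tmul, hx, hy]
    | tmul r s => simp [TensorProduct.smul_tmul']
  rw [onFirstTwo_tmul, e₄] at h
  rw [TensorProduct.sub_tmul, map_sub, h]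
  simp [TensorProduct.smul_tmul']

theorem counit_left (hC : IsLeftComodule HA C) (hY : IsNondegenerate Y) (y : Y) (a : A) :
    TensorProduct.lid k Y (HA.counit.rTensor Y (C.Tbar (a ⊗ₜ y))) = HA.counit a • y := by
  by_cases hA : ∀ c : A, c = 0
  · simp [hA a]
  push Not at hA
  have : Nontrivial A := ⟨hA.choose, 0, hA.choose_spec⟩
  obtain ⟨b, hb⟩ := HA.exists_counit_eq_one
  -- Apply `ε ⊗ ι` to `(a ⊗ 1)ρ(y)(b ⊗ 1)`, bracketed in both ways; as `ε` is multiplicative and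
  -- `ε(b) = 1`, this reduces to the right-hand version.
  have h := congrArg (fun x => TensorProduct.lid k Y (HA.counit.rTensor Y x))
    (C.rTensor_mulRight_Tbar HA.nondegenerate hY y a b)
  have e₁ : ∀ x : A ⊗[k] Y, TensorProduct.lid k Y (HA.counit.rTensor Y
      ((LinearMap.mulRight k b).rTensor Y x)) =
      TensorProduct.lid k Y (HA.counit.rTensor Y x) := fun x => by
    induction x using TensorProduct.induction_on with
    | zero => simp
    | add x y hx hy => simp only [map_add, hx, hy]
    | tmul p q => simp [HA.counit_mul, hb]
  have e₂ : ∀ x : A ⊗[k] Y, TensorProduct.lid k Y (HA.counit.rTensor Y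
      ((LinearMap.mulLeft k a).rTensor Y x)) =
      HA.counit a • TensorProduct.lid k Y (HA.counit.rTensor Y x) := fun x => by
    induction x using TensorProduct.induction_on with
    | zero => simp
    | add x y hx hy => simp only [map_add, smul_add, hx, hy]
    | tmul p q => simp [HA.counit_mul, smul_smul]
  simp only [e₁, e₂] at h
  rw [h, hC.counit_right hY, hb, one_smul]

/-- The coassociativity of a comodule, multiplied on the right by `Δ(a)(b ⊗ 1) ⊗ 1`. -/
theorem coassoc_right' (hC : IsLeftComodule HA C) (hY : IsNondegenerate Y) (y : Y) (a b : A) :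
    C.T.lTensor A (onFirstTwo A C.T (y ⊗ₜ[k] HA.ΔR₁ (a ⊗ₜ[k] b))) =
      TensorProduct.assoc k A A Y
        ((HA.ΔR₁ ∘ₗ (TensorProduct.mk k A A).flip b).rTensor Y (C.T (y ⊗ₜ[k] a))) := by
  -- Covering the middle leg by `c` reduces to `coassoc_right`, because `Δ(a)(b ⊗ 1)(1 ⊗ c) = Δ(a)(1
  -- ⊗ c)(b ⊗ 1)`.
  apply eq_of_lTensor_rTensor_mulRight HA.nondegenerate
  intro c
  have e₁ : ∀ u : A ⊗[k] A, ((LinearMap.mulRight k c).rTensor Y).lTensor A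
      (C.T.lTensor A (onFirstTwo A C.T (y ⊗ₜ[k] u))) =
      C.T.lTensor A (onFirstTwo A C.T (y ⊗ₜ[k] (LinearMap.mulRight k c).lTensor A u)) :=
      fun u => by
    induction u using TensorProduct.induction_on with
    | zero => simp
    | add x y hx hy => simp only [map_add, TensorProduct.tmul_add, hx, hy]
    | tmul p q =>
      rw [LinearMap.lTensor_tmul, onFirstTwo_tmul, onFirstTwo_tmul]
      generalize C.T (y ⊗ₜ p) = v
      induction v using TensorProduct.induction_on with
      | zero => simp
      | add x y hx hy => simp only [map_add, TensorProduct.add_tmul, hx, hy]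
      | tmul r s => simp [C.T_tmul_mul HA.nondegenerate hY]
  have e₂ : ∀ u : A ⊗[k] A, C.T.lTensor A (onFirstTwo A C.T
      (y ⊗ₜ[k] (LinearMap.mulRight k b).rTensor A u)) =
      (LinearMap.mulRight k b).rTensor (A ⊗[k] Y)
        (C.T.lTensor A (onFirstTwo A C.T (y ⊗ₜ[k] u))) := fun u => by
    induction u using TensorProduct.induction_on with
    | zero => simp
    | add x y hx hy => simp only [map_add, TensorProduct.tmul_add, hx, hy]
    | tmul p q =>
      rw [LinearMap.rTensor_tmul, onFirstTwo_tmul, onFirstTwo_tmul, LinearMap.mulRight_apply,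
        C.T_tmul_mul HA.nondegenerate hY]
      generalize C.T (y ⊗ₜ p) = v
      induction v using TensorProduct.induction_on with
      | zero => simp
      | add x y hx hy => simp only [map_add, TensorProduct.add_tmul, hx, hy]
      | tmul r s => simp
  have e₃ : ∀ (u : A ⊗[k] A) (z : Y), ((LinearMap.mulRight k c).rTensor Y).lTensor A
      (TensorProduct.assoc k A A Y (u ⊗ₜ z)) =
      TensorProduct.assoc k A A Y ((LinearMap.mulRight k c).lTensor A u ⊗ₜ z) := fun u z => by
    induction u using TensorProduct.induction_on with
    | zero => simp
    | add x y hx hy => simp only [map_add, TensorProduct.add_tmul, hx, hy]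
    | tmul p q => simp
  have e₄ : ∀ (u : A ⊗[k] A) (z : Y), (LinearMap.mulRight k b).rTensor (A ⊗[k] Y)
      (TensorProduct.assoc k A A Y (u ⊗ₜ z)) =
      TensorProduct.assoc k A A Y ((LinearMap.mulRight k b).rTensor A u ⊗ₜ z) := fun u z => by
    induction u using TensorProduct.induction_on with
    | zero => simp
    | add x y hx hy => simp only [map_add, TensorProduct.add_tmul, hx, hy]
    | tmul p q => simp
  rw [e₁, HA.lTensor_mulRight_ΔR₁, e₂, hC.coassoc_right]
  generalize C.T (y ⊗ₜ a) = v
  induction v using TensorProduct.induction_on with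
  | zero => simp
  | add x y hx hy => simp only [map_add, hx, hy]
  | tmul r s => simp [e₃, e₄, HA.lTensor_mulRight_ΔR₁]

/-- If `T(x) = 0` with `x = ∑ yᵢ ⊗ aᵢ`, then coassociativity and the counit identity yield `∑ yᵢ ⊗
S⁻¹(c)aᵢ = 0` for every `c`, hence `x = 0`. -/
theorem T_injective (hC : IsLeftComodule HA C) (hY : IsNondegenerate Y) :
    Function.Injective C.T := by
  rw [injective_iff_map_eq_zero]
  intro x hx
  apply eq_zero_of_lTensor
    (fun c : A => HA.antipodeInvMul ∘ₗ (TensorProduct.mk k A A).flip c)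
    HA.eq_zero_of_antipodeInvMul
  intro c
  have e₁ : ∀ v : Y ⊗[k] (A ⊗[k] A), C.T.lTensor A (onFirstTwo A C.T (HA.ΔR₁.lTensor Y v)) =
      TensorProduct.assoc k A A Y (HA.ΔR₁.rTensor Y ((TensorProduct.assoc k A A Y).symm
        ((TensorProduct.comm k Y A).toLinearMap.lTensor A (onFirstTwo A C.T v)))) := fun v => by
    induction v using TensorProduct.induction_on with
    | zero => simp
    | add x y hx hy => simp only [map_add, hx, hy]
    | tmul y v =>
      induction v using TensorProduct.induction_on with
      | zero => simp
      | add x y hx hy => simp only [map_add, TensorProduct.tmul_add, hx, hy]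
      | tmul d p =>
        rw [LinearMap.lTensor_tmul, hC.coassoc_right' hY, onFirstTwo_tmul]
        generalize C.T (y ⊗ₜ d) = u
        induction u using TensorProduct.induction_on with
        | zero => simp
        | add x y hx hy => simp only [map_add, TensorProduct.add_tmul, hx, hy]
        | tmul r s => simp
  have e₂ : ∀ v : Y ⊗[k] (A ⊗[k] A), TensorProduct.lid k (Y ⊗[k] A)
      (HA.counit.rTensor (Y ⊗[k] A) (onFirstTwo A C.T v)) =
      (HA.antipodeInvMul ∘ₗ HA.ΔR₁).lTensor Y v := fun v => by
    induction v using TensorProduct.induction_on with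
    | zero => simp
    | add x y hx hy => simp only [map_add, hx, hy]
    | tmul y v =>
      induction v using TensorProduct.induction_on with
      | zero => simp
      | add x y hx hy => simp only [map_add, TensorProduct.tmul_add, hx, hy]
      | tmul d p =>
        have e : ∀ u : A ⊗[k] Y, TensorProduct.lid k (Y ⊗[k] A) (HA.counit.rTensor (Y ⊗[k] A)
            (TensorProduct.assoc k A Y A (u ⊗ₜ p))) =
            TensorProduct.lid k Y (HA.counit.rTensor Y u) ⊗ₜ p := fun u => by
          induction u using TensorProduct.induction_on with
          | zero => simp
          | add x y hx hy => simp only [map_add, TensorProduct.add_tmul, hx, hy]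
          | tmul r s => simp [TensorProduct.smul_tmul']
        rw [onFirstTwo_tmul, e, hC.counit_right hY]
        simp [HA.antipodeInvMul_ΔR₁, TensorProduct.smul_tmul]
  -- Writing `x ⊗ c` as `(ι ⊗ ΔR₁)v` makes `e₁` applicable: its left side is `(ι ⊗ T)(T(x) ⊗ c) =
  -- 0`, and injectivity of `ΔR₁` gives `(T ⊗ ι)v = 0`, which `e₂` turns into the claim.
  obtain ⟨v, hv⟩ := (LinearMap.lTensor_surjective Y HA.ΔR₁_bijective.2)
    (TensorProduct.assoc k Y A A (x ⊗ₜ c))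
  have h0 : onFirstTwo A C.T v = 0 := by
    have h := e₁ v
    rw [hv, onFirstTwo_assoc_tmul, hx, TensorProduct.zero_tmul, map_zero, map_zero, eq_comm,
      LinearEquiv.map_eq_zero_iff] at h
    have inj : Function.Injective (HA.ΔR₁.rTensor Y) :=
      Module.Flat.rTensor_preserves_injective_linearMap _ HA.ΔR₁_bijective.1
    rw [map_eq_zero_iff _ inj, LinearEquiv.map_eq_zero_iff] at h
    exact (map_eq_zero_iff _ (Module.Flat.lTensor_preserves_injective_linearMap _
      (TensorProduct.comm k Y A).injective)).1 h
  have h := e₂ v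
  rw [h0, map_zero, map_zero, LinearMap.lTensor_comp, LinearMap.comp_apply, hv] at h
  rw [h]
  clear hx hv h
  induction x using TensorProduct.induction_on with
  | zero => simp
  | add x y hx hy => simp only [map_add, TensorProduct.add_tmul, hx, hy]
  | tmul r s => simp

end IsLeftComodule

end Coactions

/-! ### Covered elements: uniqueness, linearity, and compatibility with coassociativity. -/

section Covers

variable {k A Y : Type*} [Field k] [NonUnitalRing A] [Module k A] [IsScalarTower k A A]
  [SMulCommClass k A A] [NonUnitalRing Y] [Module k Y] [IsScalarTower k Y Y] [SMulCommClass k Y Y]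
  {HA : RegularMultiplierHopfAlgebra k A} {HY : RegularMultiplierHopfAlgebra k Y}
  {C : CoactionMap k A Y}

theorem IsRightCover.unique {y : Y} {a : A} {w : Y} {x x' : Y ⊗[k] (A ⊗[k] Y)}
    (h : IsRightCover HY C y a w x) (h' : IsRightCover HY C y a w x') : x = x' :=
  eq_of_rTensor_mulRight HY.nondegenerate fun v => (h v).1.trans (h' v).1.symm

theorem IsLeftCover.unique {y : Y} {a : A} {w : Y} {x x' : Y ⊗[k] (A ⊗[k] Y)}
    (h : IsLeftCover HY C y a w x) (h' : IsLeftCover HY C y a w x') : x = x' :=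
  eq_of_rTensor_mulRight HY.nondegenerate fun v => (h v).1.trans (h' v).1.symm

theorem CoactionMap.Tat_add (a b : A) : C.Tat (a + b) = C.Tat a + C.Tat b := by
  ext y
  simp [CoactionMap.Tat]

theorem CoactionMap.Tat_smul (r : k) (a : A) : C.Tat (r • a) = r • C.Tat a := by
  ext y
  simp [CoactionMap.Tat]

theorem IsRightCover.add_left {y y' : Y} {a : A} {w : Y} {x x' : Y ⊗[k] (A ⊗[k] Y)}
    (h : IsRightCover HY C y a w x) (h' : IsRightCover HY C y' a w x') :
    IsRightCover HY C (y + y') a w (x + x') := fun v =>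
  ⟨by simp only [map_add, TensorProduct.add_tmul, (h v).1, (h' v).1],
    by simp only [map_add, TensorProduct.tmul_add, (h v).2, (h' v).2]⟩

theorem IsRightCover.add_right {y : Y} {a a' : A} {w : Y} {x x' : Y ⊗[k] (A ⊗[k] Y)}
    (h : IsRightCover HY C y a w x) (h' : IsRightCover HY C y a' w x') :
    IsRightCover HY C y (a + a') w (x + x') := fun v =>
  ⟨by simp only [map_add, CoactionMap.Tat_add, LinearMap.lTensor_add, LinearMap.add_apply,
      (h v).1, (h' v).1],
    by simp only [map_add, CoactionMap.Tat_add, LinearMap.lTensor_add, LinearMap.add_apply,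
      (h v).2, (h' v).2]⟩

theorem IsRightCover.smul_left (r : k) {y : Y} {a : A} {w : Y} {x : Y ⊗[k] (A ⊗[k] Y)}
    (h : IsRightCover HY C y a w x) : IsRightCover HY C (r • y) a w (r • x) := fun v =>
  ⟨by simp only [map_smul, ← TensorProduct.smul_tmul', (h v).1],
    by simp only [map_smul, TensorProduct.tmul_smul, (h v).2]⟩

theorem IsRightCover.smul_right (r : k) {y : Y} {a : A} {w : Y} {x : Y ⊗[k] (A ⊗[k] Y)}
    (h : IsRightCover HY C y a w x) : IsRightCover HY C y (r • a) w (r • x) := fun v =>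
  ⟨by simp only [map_smul, CoactionMap.Tat_smul, LinearMap.lTensor_smul, LinearMap.smul_apply,
      (h v).1],
    by simp only [map_smul, CoactionMap.Tat_smul, LinearMap.lTensor_smul, LinearMap.smul_apply,
      (h v).2]⟩

/-- The covered elements `((id ⊗ T)(Δ(y) ⊗ a))(1 ⊗ 1 ⊗ w)` depend linearly on `y ⊗ a`. -/
theorem HasCovers.exists_linearMap (h : HasCovers HY C) (w : Y) :
    ∃ X : Y ⊗[k] A →ₗ[k] Y ⊗[k] (A ⊗[k] Y), ∀ y a, IsRightCover HY C y a w (X (y ⊗ₜ a)) := by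
  choose X hX using fun y a => (h y a w).1
  exact ⟨TensorProduct.lift (LinearMap.mk₂ k X
    (fun y y' a => (hX _ a).unique ((hX y a).add_left (hX y' a)))
    (fun r y a => (hX _ a).unique ((hX y a).smul_left r))
    (fun y a a' => (hX y _).unique ((hX y a).add_right (hX y a')))
    (fun r y a => (hX y _).unique ((hX y a).smul_right r))), fun y a => by simpa using hX y a⟩

/-- With `X(y ⊗ a) = ((id ⊗ T)(Δ(y) ⊗ a))(1 ⊗ 1 ⊗ w)`,
`(T ⊗ id ⊗ id)(id ⊗ Δ(·)(1 ⊗ c) ⊗ id)X(y ⊗ a) = (id ⊗ X)(T ⊗ id)(y ⊗ Δ(a)(1 ⊗ c))`. -/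
theorem IsComoduleCoalgebra.onFirstTwo_cover (hC : IsComoduleCoalgebra HA HY C) {w : Y}
    {X : Y ⊗[k] A →ₗ[k] Y ⊗[k] (A ⊗[k] Y)} (hX : ∀ y a, IsRightCover HY C y a w (X (y ⊗ₜ a)))
    (y : Y) (a c : A) :
    onFirstTwo (A ⊗[k] Y) C.T (((TensorProduct.assoc k A A Y).toLinearMap ∘ₗ
      (HA.ΔR₂ ∘ₗ (TensorProduct.mk k A A).flip c).rTensor Y).lTensor Y (X (y ⊗ₜ a))) =
    X.lTensor A (onFirstTwo A C.T (y ⊗ₜ[k] HA.ΔR₂ (a ⊗ₜ[k] c))) := by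
  have hco := hC.isLeftComodule
  have hΔ : onFirstTwo Y C.T ∘ₗ X =
      (HY.ΔR₂ ∘ₗ (TensorProduct.mk k Y Y).flip w).lTensor A ∘ₗ C.T :=
    TensorProduct.ext' fun z b => ((hC.isDeltaCompatible z b w).1 _ (hX z b)).symm
  have inj : Function.Injective ((onFirstTwo Y C.T).lTensor A) := by
    apply Module.Flat.lTensor_preserves_injective_linearMap
    exact (TensorProduct.assoc k A Y Y).injective.comp
      ((Module.Flat.rTensor_preserves_injective_linearMap _
        (hco.T_injective HY.nondegenerate)).comp (TensorProduct.assoc k Y A Y).symm.injective)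
  -- After `ι ⊗ T ⊗ ι` both sides equal `(Δ_A(·)(1 ⊗ c) ⊗ Δ_Y(·)(1 ⊗ w))T(y ⊗ a)`: the left by
  -- coassociativity and then (b), the right by (b) and then coassociativity.
  apply inj
  have e₁ : ∀ (z z' : Y) (u : A ⊗[k] A), (onFirstTwo Y C.T).lTensor A (onFirstTwo (A ⊗[k] Y) C.T
      (z ⊗ₜ TensorProduct.assoc k A A Y (u ⊗ₜ z'))) =
      (TensorProduct.assoc k A Y Y).toLinearMap.lTensor A (TensorProduct.assoc k A (A ⊗[k] Y) Y
        (C.T.lTensor A (onFirstTwo A C.T (z ⊗ₜ u)) ⊗ₜ z')) := fun z z' u => by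
    induction u using TensorProduct.induction_on with
    | zero => simp
    | add x y hx hy =>
      simp only [map_add, TensorProduct.tmul_add, TensorProduct.add_tmul, hx, hy]
    | tmul p q =>
      rw [TensorProduct.assoc_tmul, onFirstTwo_tmul, onFirstTwo_tmul]
      generalize C.T (z ⊗ₜ p) = v
      induction v using TensorProduct.induction_on with
      | zero => simp
      | add x y hx hy => simp only [map_add, TensorProduct.add_tmul, hx, hy]
      | tmul r s => simp [onFirstTwo_tmul]
  have e₂ : ∀ (z' : Y) (u : A ⊗[k] Y),
      (TensorProduct.assoc k A Y Y).toLinearMap.lTensor A (TensorProduct.assoc k A (A ⊗[k] Y) Y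
        (TensorProduct.assoc k A A Y
          ((HA.ΔR₂ ∘ₗ (TensorProduct.mk k A A).flip c).rTensor Y u) ⊗ₜ z')) =
      TensorProduct.assoc k A A (Y ⊗[k] Y)
        ((HA.ΔR₂ ∘ₗ (TensorProduct.mk k A A).flip c).rTensor (Y ⊗[k] Y)
          (TensorProduct.assoc k A Y Y (u ⊗ₜ z'))) := fun z' u => by
    induction u using TensorProduct.induction_on with
    | zero => simp
    | add x y hx hy => simp only [map_add, TensorProduct.add_tmul, hx, hy]
    | tmul p q =>
      simp only [LinearMap.rTensor_tmul, TensorProduct.assoc_tmul]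
      generalize (HA.ΔR₂ ∘ₗ (TensorProduct.mk k A A).flip c) p = v
      induction v using TensorProduct.induction_on with
      | zero => simp
      | add x y hx hy => simp only [map_add, TensorProduct.add_tmul, hx, hy]
      | tmul r s => simp
  have e₃ : ∀ x : Y ⊗[k] (A ⊗[k] Y), (onFirstTwo Y C.T).lTensor A (onFirstTwo (A ⊗[k] Y) C.T
      (((TensorProduct.assoc k A A Y).toLinearMap ∘ₗ
        (HA.ΔR₂ ∘ₗ (TensorProduct.mk k A A).flip c).rTensor Y).lTensor Y x)) =
      TensorProduct.assoc k A A (Y ⊗[k] Y)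
        ((HA.ΔR₂ ∘ₗ (TensorProduct.mk k A A).flip c).rTensor (Y ⊗[k] Y)
          (onFirstTwo Y C.T x)) := fun x => by
    induction x using TensorProduct.induction_on with
    | zero => simp
    | add x y hx hy => simp only [map_add, hx, hy]
    | tmul z x =>
      induction x using TensorProduct.induction_on with
      | zero => simp
      | add x y hx hy => simp only [map_add, TensorProduct.tmul_add, hx, hy]
      | tmul b z' =>
        rw [onFirstTwo_tmul, ← e₂]
        simp only [LinearMap.lTensor_tmul, LinearMap.comp_apply, LinearMap.rTensor_tmul,
          LinearEquiv.coe_coe, LinearMap.flip_apply, TensorProduct.mk_apply]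
        rw [e₁, hco.coassoc_right]
  have e₄ : ∀ (f : Y →ₗ[k] Y ⊗[k] Y) (g : A →ₗ[k] A ⊗[k] A) (u : A ⊗[k] Y),
      (f.lTensor A).lTensor A (TensorProduct.assoc k A A Y (g.rTensor Y u)) =
      TensorProduct.assoc k A A (Y ⊗[k] Y) (g.rTensor (Y ⊗[k] Y) (f.lTensor A u)) :=
      fun f g u => by
    induction u using TensorProduct.induction_on with
    | zero => simp
    | add x y hx hy => simp only [map_add, hx, hy]
    | tmul p q =>
      simp only [LinearMap.rTensor_tmul, LinearMap.lTensor_tmul]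
      generalize g p = v
      induction v using TensorProduct.induction_on with
      | zero => simp
      | add x y hx hy => simp only [map_add, TensorProduct.add_tmul, hx, hy]
      | tmul r s => simp
  rw [e₃, ← LinearMap.comp_apply (onFirstTwo Y C.T) X, hΔ, LinearMap.comp_apply, ← e₄,
    ← hco.coassoc_right, ← LinearMap.lTensor_comp_apply, ← LinearMap.lTensor_comp_apply, hΔ]

end Covers

/-! ### Building a coaction from its two covered maps. -/

section Construction

variable {k A Y : Type*} [Field k] [NonUnitalRing A] [Module k A] [IsScalarTower k A A]
  [SMulCommClass k A A] [NonUnitalRing Y] [Module k Y] [IsScalarTower k Y Y] [SMulCommClass k Y Y]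

theorem mul_tmul_eq (u : A ⊗[k] Y) (p : A) (q : Y) : u * (p ⊗ₜ q) =
    (LinearMap.mulRight k q).lTensor A ((LinearMap.mulRight k p).rTensor Y u) := by
  induction u using TensorProduct.induction_on with
  | zero => simp
  | add x y hx hy => simp only [map_add, add_mul, hx, hy]
  | tmul r s => simp

theorem tmul_mul_eq (u : A ⊗[k] Y) (p : A) (q : Y) : (p ⊗ₜ q) * u =
    (LinearMap.mulLeft k q).lTensor A ((LinearMap.mulLeft k p).rTensor Y u) := by
  induction u using TensorProduct.induction_on with
  | zero => simp
  | add x y hx hy => simp only [map_add, mul_add, hx, hy]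
  | tmul r s => simp

theorem lTensor_mulLeft_mulRight {V : Type*} [AddCommGroup V] [Module k V] (u : V ⊗[k] Y)
    (p q : Y) :
    (LinearMap.mulLeft k p).lTensor V ((LinearMap.mulRight k q).lTensor V u) =
      (LinearMap.mulRight k q).lTensor V ((LinearMap.mulLeft k p).lTensor V u) := by
  induction u using TensorProduct.induction_on with
  | zero => simp
  | add x y hx hy => simp only [map_add, hx, hy]
  | tmul r s => simp [mul_assoc]

theorem rTensor_lTensor_comm {M N M' N' : Type*} [AddCommGroup M] [Module k M]
    [AddCommGroup N] [Module k N] [AddCommGroup M'] [Module k M'] [AddCommGroup N'] [Module k N']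
    (f : M →ₗ[k] M') (g : N →ₗ[k] N') (u : M ⊗[k] N) :
    f.rTensor N' (g.lTensor M u) = g.lTensor M' (f.rTensor N u) := by
  rw [← LinearMap.comp_apply, ← LinearMap.comp_apply, LinearMap.lTensor_comp_rTensor,
    LinearMap.rTensor_comp_lTensor]

/-- The coaction `ρ` with `ρ(y)(a ⊗ 1) = T(y ⊗ a)` and `(a ⊗ 1)ρ(y) = T'(a ⊗ y)`. -/
noncomputable def CoactionMap.ofMaps (T : Y ⊗[k] A →ₗ[k] A ⊗[k] Y) (Tbar : A ⊗[k] Y →ₗ[k] A ⊗[k] Y)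
    (hT : ∀ y a b, T (y ⊗ₜ (a * b)) = (LinearMap.mulRight k b).rTensor Y (T (y ⊗ₜ a)))
    (hTbar : ∀ y a b, Tbar ((a * b) ⊗ₜ y) = (LinearMap.mulLeft k a).rTensor Y (Tbar (b ⊗ₜ y)))
    (h : ∀ y a b, (LinearMap.mulRight k b).rTensor Y (Tbar (a ⊗ₜ y)) =
      (LinearMap.mulLeft k a).rTensor Y (T (y ⊗ₜ b))) : CoactionMap k A Y :=
  let l : Y → A ⊗[k] Y →ₗ[k] A ⊗[k] Y := fun y =>
    (LinearMap.mul' k Y).lTensor A ∘ₗ (TensorProduct.assoc k A Y Y).toLinearMap ∘ₗ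
      (T ∘ₗ TensorProduct.mk k Y A y).rTensor Y
  let r : Y → A ⊗[k] Y →ₗ[k] A ⊗[k] Y := fun y =>
    (LinearMap.mul' k Y ∘ₗ (TensorProduct.comm k Y Y).toLinearMap).lTensor A ∘ₗ
      (TensorProduct.assoc k A Y Y).toLinearMap ∘ₗ
        (Tbar ∘ₗ (TensorProduct.mk k A Y).flip y).rTensor Y
  have hl : ∀ y a z, l y (a ⊗ₜ z) = (LinearMap.mulRight k z).lTensor A (T (y ⊗ₜ a)) := by
    intro y a z
    simp only [l, LinearMap.comp_apply, LinearMap.rTensor_tmul, TensorProduct.mk_apply]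
    generalize T (y ⊗ₜ a) = u
    induction u using TensorProduct.induction_on with
    | zero => simp
    | add x y hx hy => simp only [map_add, TensorProduct.add_tmul, hx, hy]
    | tmul r s => simp
  have hr : ∀ y a z, r y (a ⊗ₜ z) = (LinearMap.mulLeft k z).lTensor A (Tbar (a ⊗ₜ y)) := by
    intro y a z
    simp only [r, LinearMap.comp_apply, LinearMap.rTensor_tmul, TensorProduct.mk_apply,
      LinearMap.flip_apply]
    generalize Tbar (a ⊗ₜ y) = u
    induction u using TensorProduct.induction_on with
    | zero => simp
    | add x y hx hy => simp only [map_add, TensorProduct.add_tmul, hx, hy]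
    | tmul r s => simp
  { ρ :=
      { toFun := fun y => ⟨(l y, MulOpposite.op (r y)), fun u v => by
          change u * l y v = r y u * v
          induction u using TensorProduct.induction_on with
          | zero => simp
          | add u u' hu hu' => rw [add_mul, hu, hu', map_add, add_mul]
          | tmul a z =>
            induction v using TensorProduct.induction_on with
            | zero => simp
            | add v v' hv hv' => rw [map_add, mul_add, hv, hv', mul_add]
            | tmul b z' =>
              -- The multiplier condition on `a ⊗ z` and `b ⊗ z'` is the hypothesis `h`, covered by
              -- `z` on the left and `z'` on the right in the second leg.
              rw [hl, hr, mul_tmul_eq, tmul_mul_eq, rTensor_lTensor_comm, rTensor_lTensor_comm,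
                h, lTensor_mulLeft_mulRight]⟩
        map_add' := fun y y' => Multiplier.ext_apply
          (fun a z => by
            change l (y + y') _ = l y _ + l y' _
            simp only [hl, TensorProduct.add_tmul, map_add])
          (fun a z => by
            change r (y + y') _ = r y _ + r y' _
            simp only [hr, TensorProduct.tmul_add, map_add])
        map_smul' := fun c y => Multiplier.ext_apply
          (fun a z => by
            change l (c • y) _ = c • l y _
            simp only [hl, ← TensorProduct.smul_tmul', map_smul])
          (fun a z => by
            change r (c • y) _ = c • r y _
            simp only [hr, TensorProduct.tmul_smul, map_smul]) }
    T := T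
    Tbar := Tbar
    T_spec := fun y a => Multiplier.ext_apply
      (fun b z => by
        change T (y ⊗ₜ a) * (b ⊗ₜ z) = l y ((a * b) ⊗ₜ z)
        rw [hl, hT, mul_tmul_eq])
      (fun b z => by
        change (b ⊗ₜ z) * T (y ⊗ₜ a) = (LinearMap.mulRight k a).rTensor Y (r y (b ⊗ₜ z))
        rw [hr, tmul_mul_eq, ← h, rTensor_lTensor_comm])
    Tbar_spec := fun a y => Multiplier.ext_apply
      (fun b z => by
        change Tbar (a ⊗ₜ y) * (b ⊗ₜ z) = (LinearMap.mulLeft k a).rTensor Y (l y (b ⊗ₜ z))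
        rw [hl, mul_tmul_eq, h, rTensor_lTensor_comm])
      (fun b z => by
        change (b ⊗ₜ z) * Tbar (a ⊗ₜ y) = r y ((b * a) ⊗ₜ z)
        rw [hr, hTbar, tmul_mul_eq]) }

end Construction

/-! ### Moving maps on one leg through a tensor product of maps. -/

section TensorMaps

variable {k M N V W : Type*} [Field k] [AddCommGroup M] [Module k M] [AddCommGroup N] [Module k N]
  [AddCommGroup V] [Module k V] [AddCommGroup W] [Module k W]

theorem rTensor_map_of_comm {p : M →ₗ[k] N} {q : V →ₗ[k] W} {f : M →ₗ[k] M} {g : N →ₗ[k] N}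
    (hfg : p ∘ₗ f = g ∘ₗ p) (x : M ⊗[k] V) :
    g.rTensor W (TensorProduct.map p q x) = TensorProduct.map p q (f.rTensor V x) := by
  rw [← LinearMap.comp_apply, ← LinearMap.comp_apply, LinearMap.rTensor_comp_map,
    LinearMap.map_comp_rTensor, hfg]

theorem lTensor_map_of_comm {p : M →ₗ[k] N} {q : V →ₗ[k] W} {f : V →ₗ[k] V} {g : W →ₗ[k] W}
    (hfg : q ∘ₗ f = g ∘ₗ q) (x : M ⊗[k] V) :
    g.lTensor N (TensorProduct.map p q x) = TensorProduct.map p q (f.lTensor M x) := by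
  rw [← LinearMap.comp_apply, ← LinearMap.comp_apply, LinearMap.lTensor_comp_map,
    LinearMap.map_comp_lTensor, hfg]

end TensorMaps

/-! ### The projection as a `Y`-bimodule map. -/

namespace AlgebraProjection

theorem toSub_coe {k Z : Type*} [Field k] [NonUnitalRing Z] [Module k Z]
    {Y : NonUnitalSubalgebra k Z} (P : AlgebraProjection Y) (y : Y) : P.toSub (y : Z) = y :=
  Subtype.ext (P.apply_of_mem y y.2)

theorem toSub_mul {k Z : Type*} [Field k] [NonUnitalRing Z] [Module k Z]
    {Y : NonUnitalSubalgebra k Z} (P : AlgebraProjection Y) (a b : Z) :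
    P.toSub (a * b) = P.toSub a * P.toSub b :=
  Subtype.ext (map_mul P.π a b)

theorem toSub_comp_mulRight {k Z : Type*} [Field k] [NonUnitalRing Z] [Module k Z]
    [IsScalarTower k Z Z] {Y : NonUnitalSubalgebra k Z}
    (P : AlgebraProjection Y) (w : Y) :
    P.toSub ∘ₗ LinearMap.mulRight k (w : Z) = LinearMap.mulRight k w ∘ₗ P.toSub :=
  LinearMap.ext fun z => by simp [toSub_mul, toSub_coe]

theorem toSub_comp_mulLeft {k Z : Type*} [Field k] [NonUnitalRing Z] [Module k Z]
    [SMulCommClass k Z Z] {Y : NonUnitalSubalgebra k Z}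
    (P : AlgebraProjection Y) (w : Y) :
    P.toSub ∘ₗ LinearMap.mulLeft k (w : Z) = LinearMap.mulLeft k w ∘ₗ P.toSub :=
  LinearMap.ext fun z => by simp [toSub_mul, toSub_coe]

end AlgebraProjection

/-! ### Transporting the comodule coalgebra structure along the projection. -/

section Projections

variable {k A Z : Type*} [Field k] [NonUnitalRing A] [Module k A] [IsScalarTower k A A]
  [SMulCommClass k A A] [NonUnitalRing Z] [Module k Z] [IsScalarTower k Z Z] [SMulCommClass k Z Z]
  {HA : RegularMultiplierHopfAlgebra k A} {HZ : RegularMultiplierHopfAlgebra k Z}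
  {C : CoactionMap k A Z} {Y : NonUnitalSubalgebra k Z} {HY : RegularMultiplierHopfAlgebra k Y}

namespace AlgebraProjection

/-- Comultiplicativity is assumed only for coverings on the right. Covering by `v ∈ Y` on the right
as well reduces the left covering to it, since `π` commutes with multiplication by elements of `Y`.
-/
theorem IsComultiplicative.ΔL₁ {P : AlgebraProjection Y} (h : P.IsComultiplicative HZ HY) (z : Z)
    (y : Y) : HY.ΔL₁ (y ⊗ₜ P.toSub z) =
      TensorProduct.map P.toSub P.toSub (HZ.ΔL₁ ((y : Z) ⊗ₜ z)) := by
  apply eq_of_rTensor_mulRight HY.nondegenerate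
  intro v
  rw [HY.rTensor_mulRight_ΔL₁, (h z v).2, rTensor_map_of_comm (P.toSub_comp_mulLeft y),
    rTensor_map_of_comm (P.toSub_comp_mulRight v), HZ.rTensor_mulRight_ΔL₁]

theorem IsComultiplicative.ΔL₂ {P : AlgebraProjection Y} (h : P.IsComultiplicative HZ HY) (z : Z)
    (y : Y) : HY.ΔL₂ (y ⊗ₜ P.toSub z) =
      TensorProduct.map P.toSub P.toSub (HZ.ΔL₂ ((y : Z) ⊗ₜ z)) := by
  apply eq_of_lTensor_mulRight HY.nondegenerate
  intro v
  rw [HY.lTensor_mulRight_ΔL₂, (h z v).1, lTensor_map_of_comm (P.toSub_comp_mulLeft y),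
    lTensor_map_of_comm (P.toSub_comp_mulRight v), HZ.lTensor_mulRight_ΔL₂]

/-- The coaction `(id ⊗ π)ρ` of `A` on `Y`. -/
noncomputable def coaction (P : AlgebraProjection Y) (C : CoactionMap k A Z)
    (hA : IsNondegenerate A) (hZ : IsNondegenerate Z) : CoactionMap k A Y :=
  CoactionMap.ofMaps (P.toSub.lTensor A ∘ₗ C.T ∘ₗ (inclusionMap Y).rTensor A)
    (P.toSub.lTensor A ∘ₗ C.Tbar ∘ₗ (inclusionMap Y).lTensor A)
    (fun y a b => by simp [rTensor_lTensor_comm, C.T_tmul_mul hA hZ])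
    (fun y a b => by simp [rTensor_lTensor_comm, C.Tbar_mul_tmul hA hZ])
    (fun y a b => by simp [rTensor_lTensor_comm, C.rTensor_mulRight_Tbar hA hZ])

variable {P : AlgebraProjection Y} {β : CoactionMap k A Y}

theorem lTensor_Tat_map
    (hβ : ∀ z a, β.T (P.toSub z ⊗ₜ a) = P.toSub.lTensor A (C.T (z ⊗ₜ a)))
    {f : Z →ₗ[k] Z} {g : Y →ₗ[k] Y} (hfg : P.toSub ∘ₗ f = g ∘ₗ P.toSub) (a : A) (u : Z ⊗[k] Z) :
    (g.lTensor A).lTensor Y ((β.Tat a).lTensor Y (TensorProduct.map P.toSub P.toSub u)) =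
      TensorProduct.map P.toSub (P.toSub.lTensor A)
        ((f.lTensor A).lTensor Z ((C.Tat a).lTensor Z u)) := by
  induction u using TensorProduct.induction_on with
  | zero => simp
  | add x y hx hy => simp only [map_add, hx, hy]
  | tmul z z' =>
    simp only [TensorProduct.map_tmul, LinearMap.lTensor_tmul, CoactionMap.Tat,
      LinearMap.comp_apply, LinearMap.flip_apply, TensorProduct.mk_apply, hβ,
      ← LinearMap.lTensor_comp_apply, hfg]

theorem isRightCover_map (h : P.IsComultiplicative HZ HY)
    (hβ : ∀ z a, β.T (P.toSub z ⊗ₜ a) = P.toSub.lTensor A (C.T (z ⊗ₜ a)))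
    {z : Z} {a : A} {w : Y} {x : Z ⊗[k] (A ⊗[k] Z)} (hx : IsRightCover HZ C z a w x) :
    IsRightCover HY β (P.toSub z) a w (TensorProduct.map P.toSub (P.toSub.lTensor A) x) :=
  fun v =>
  ⟨by rw [(h z v).2, lTensor_Tat_map hβ (P.toSub_comp_mulRight w),
      rTensor_map_of_comm (P.toSub_comp_mulRight v), (hx v).1],
    by rw [h.ΔL₁, lTensor_Tat_map hβ (P.toSub_comp_mulRight w),
      rTensor_map_of_comm (P.toSub_comp_mulLeft v), (hx v).2]⟩

theorem isLeftCover_map (h : P.IsComultiplicative HZ HY)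
    (hβ : ∀ z a, β.T (P.toSub z ⊗ₜ a) = P.toSub.lTensor A (C.T (z ⊗ₜ a)))
    {z : Z} {a : A} {w : Y} {x : Z ⊗[k] (A ⊗[k] Z)} (hx : IsLeftCover HZ C z a w x) :
    IsLeftCover HY β (P.toSub z) a w (TensorProduct.map P.toSub (P.toSub.lTensor A) x) :=
  fun v =>
  ⟨by rw [(h z v).2, lTensor_Tat_map hβ (P.toSub_comp_mulLeft w),
      rTensor_map_of_comm (P.toSub_comp_mulRight v), (hx v).1],
    by rw [h.ΔL₁, lTensor_Tat_map hβ (P.toSub_comp_mulLeft w),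
      rTensor_map_of_comm (P.toSub_comp_mulLeft v), (hx v).2]⟩

theorem hasCovers (h : P.IsComultiplicative HZ HY)
    (hβ : ∀ z a, β.T (P.toSub z ⊗ₜ a) = P.toSub.lTensor A (C.T (z ⊗ₜ a)))
    (hC : HasCovers HZ C) : HasCovers HY β := fun y a w => by
  obtain ⟨⟨x, hx⟩, ⟨x', hx'⟩⟩ := hC y a w
  have hx := isRightCover_map h hβ hx
  have hx' := isLeftCover_map h hβ hx'
  rw [toSub_coe] at hx hx'
  exact ⟨⟨_, hx⟩, ⟨_, hx'⟩⟩

theorem onFirstTwo_map (hβ : ∀ z a, β.T (P.toSub z ⊗ₜ a) = P.toSub.lTensor A (C.T (z ⊗ₜ a)))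
    (x : Z ⊗[k] (A ⊗[k] Z)) :
    onFirstTwo Y β.T (TensorProduct.map P.toSub (P.toSub.lTensor A) x) =
      (TensorProduct.map P.toSub P.toSub).lTensor A (onFirstTwo Z C.T x) := by
  induction x using TensorProduct.induction_on with
  | zero => simp
  | add x y hx hy => simp only [map_add, hx, hy]
  | tmul z x =>
    induction x using TensorProduct.induction_on with
    | zero => simp
    | add x y hx hy => simp only [map_add, TensorProduct.tmul_add, hx, hy]
    | tmul b z' =>
      rw [TensorProduct.map_tmul, LinearMap.lTensor_tmul, onFirstTwo_tmul, onFirstTwo_tmul, hβ]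
      generalize C.T (z ⊗ₜ b) = u
      induction u using TensorProduct.induction_on with
      | zero => simp
      | add x y hx hy => simp only [map_add, TensorProduct.add_tmul, hx, hy]
      | tmul r s => simp

theorem isDeltaCompatible (h : P.IsComultiplicative HZ HY)
    (hβ : ∀ z a, β.T (P.toSub z ⊗ₜ a) = P.toSub.lTensor A (C.T (z ⊗ₜ a)))
    (hC : HasCovers HZ C) (hΔ : IsDeltaCompatible HZ C) : IsDeltaCompatible HY β := by
  intro y a w
  obtain ⟨⟨X, hX⟩, ⟨X', hX'⟩⟩ := hC y a w
  have hy := hβ y a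
  have hX₁ := isRightCover_map h hβ hX
  have hX₁' := isLeftCover_map h hβ hX'
  rw [toSub_coe] at hX₁ hX₁' hy
  have hR : (HY.ΔR₂ ∘ₗ (TensorProduct.mk k Y Y).flip w) ∘ₗ P.toSub =
      TensorProduct.map P.toSub P.toSub ∘ₗ (HZ.ΔR₂ ∘ₗ (TensorProduct.mk k Z Z).flip w) :=
    LinearMap.ext fun z => (h z w).1
  have hL : (HY.ΔL₂ ∘ₗ TensorProduct.mk k Y Y w) ∘ₗ P.toSub =
      TensorProduct.map P.toSub P.toSub ∘ₗ (HZ.ΔL₂ ∘ₗ TensorProduct.mk k Z Z w) :=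
    LinearMap.ext fun z => h.ΔL₂ z w
  refine ⟨fun x hx => ?_, fun x hx => ?_⟩
  · rw [hx.unique hX₁, onFirstTwo_map hβ, ← (hΔ y a w).1 X hX, hy,
      ← LinearMap.lTensor_comp_apply, hR, LinearMap.lTensor_comp_apply]
  · rw [hx.unique hX₁', onFirstTwo_map hβ, ← (hΔ y a w).2 X' hX', hy,
      ← LinearMap.lTensor_comp_apply, hL, LinearMap.lTensor_comp_apply]

/-- The first leg may be multiplied by `t` with `ε(t) = 1` without changing `ε_Y π` of it. The
covered element then becomes `(ι ⊗ T)(Δ(z)(t ⊗ 1) ⊗ a)(1 ⊗ 1 ⊗ w)`, to which (iii) and then (ii)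
apply. -/
theorem counit_cover
    (h₂ : ∀ (a : A) (z : Z),
      P.toSub.lTensor A (C.T (P.π z ⊗ₜ[k] a)) = P.toSub.lTensor A (C.T (z ⊗ₜ[k] a)))
    (h₃ : ∀ (a : A) (z : Z) (t : Y), HY.counit t = 1 →
      P.toSub.lTensor A (C.T (P.π z ⊗ₜ[k] a)) =
        TensorProduct.lid k (A ⊗[k] Y)
          (TensorProduct.map (HY.counit ∘ₗ P.toSub) (P.toSub.lTensor A ∘ₗ C.Tat a)
            (HZ.ΔR₁ (z ⊗ₜ[k] (t : Z)))))
    {z : Z} {a : A} {w : Y} {x : Z ⊗[k] (A ⊗[k] Z)} (hx : IsRightCover HZ C z a w x) :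
    TensorProduct.lid k (A ⊗[k] Y)
      (TensorProduct.map (HY.counit ∘ₗ P.toSub) (P.toSub.lTensor A) x) =
    (LinearMap.mulRight k w).lTensor A (P.toSub.lTensor A (C.T (z ⊗ₜ a))) := by
  -- If `Y = 0` there is no `t` with `ε(t) = 1`, but then `A ⊗ Y = 0`.
  rcases subsingleton_or_nontrivial Y with hY | hY
  · have : ∀ u : A ⊗[k] Y, u = 0 := fun u => by
      induction u using TensorProduct.induction_on with
      | zero => rfl
      | add x y hx hy => rw [hx, hy, add_zero]
      | tmul r s => rw [Subsingleton.elim s 0, TensorProduct.tmul_zero]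
    rw [this (TensorProduct.lid _ _ _), this (LinearMap.lTensor _ _ _)]
  obtain ⟨t, ht⟩ := HY.exists_counit_eq_one
  have e₁ : (HY.counit ∘ₗ P.toSub) ∘ₗ LinearMap.mulRight k (t : Z) = HY.counit ∘ₗ P.toSub :=
    LinearMap.ext fun u => by simp [toSub_mul, toSub_coe, HY.counit_mul, ht]
  have e₂ : ∀ u : Z ⊗[k] Z, TensorProduct.lid k (A ⊗[k] Y)
      (TensorProduct.map (HY.counit ∘ₗ P.toSub) (P.toSub.lTensor A)
        (((LinearMap.mulRight k (w : Z)).lTensor A).lTensor Z ((C.Tat a).lTensor Z u))) =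
      (LinearMap.mulRight k w).lTensor A (TensorProduct.lid k (A ⊗[k] Y)
        (TensorProduct.map (HY.counit ∘ₗ P.toSub) (P.toSub.lTensor A ∘ₗ C.Tat a) u)) :=
      fun u => by
    induction u using TensorProduct.induction_on with
    | zero => simp
    | add x y hx hy => simp only [map_add, hx, hy]
    | tmul p q =>
      simp only [TensorProduct.map_tmul, LinearMap.lTensor_tmul, TensorProduct.lid_tmul, map_smul,
        LinearMap.comp_apply, ← LinearMap.lTensor_comp_apply, toSub_comp_mulRight]
  rw [← e₁, ← LinearMap.map_comp_rTensor, LinearMap.comp_apply, (hx t).1, e₂, ← h₃ a z t ht, h₂]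

theorem partial_coassoc (hC : IsComoduleCoalgebra HA HZ C) (h : P.IsComultiplicative HZ HY)
    (hβ : ∀ z a, β.T (P.toSub z ⊗ₜ a) = P.toSub.lTensor A (C.T (z ⊗ₜ a)))
    (hε : ∀ (z : Z) (a : A) (w : Y) (x : Z ⊗[k] (A ⊗[k] Z)), IsRightCover HZ C z a w x →
      TensorProduct.lid k (A ⊗[k] Y)
        (TensorProduct.map (HY.counit ∘ₗ P.toSub) (P.toSub.lTensor A) x) =
      (LinearMap.mulRight k w).lTensor A (P.toSub.lTensor A (C.T (z ⊗ₜ a))))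
    (y : Y) (a c : A) (w : Y) (x : Y ⊗[k] (A ⊗[k] Y)) (hx : IsRightCover HY β y a w x) :
    ((LinearMap.mulRight k w).lTensor A).lTensor A
      (β.T.lTensor A (onFirstTwo A β.T (y ⊗ₜ[k] HA.ΔR₂ (a ⊗ₜ[k] c)))) =
    ((TensorProduct.rid k A).toLinearMap ∘ₗ HY.counit.lTensor A ∘ₗ β.T).rTensor (A ⊗[k] Y)
      ((TensorProduct.assoc k Y A (A ⊗[k] Y)).symm
        (((TensorProduct.assoc k A A Y).toLinearMap ∘ₗ
          (HA.ΔR₂ ∘ₗ (TensorProduct.mk k A A).flip c).rTensor Y).lTensor Y x)) := by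
  obtain ⟨X, hX⟩ := hC.hasCovers.exists_linearMap (w : Z)
  have hX₁ := isRightCover_map h hβ (hX y a)
  rw [toSub_coe] at hX₁
  rw [hx.unique hX₁]
  set G : Z ⊗[k] (A ⊗[k] Z) →ₗ[k] A ⊗[k] Y := (TensorProduct.lid k (A ⊗[k] Y)).toLinearMap ∘ₗ
    TensorProduct.map (HY.counit ∘ₗ P.toSub) (P.toSub.lTensor A) with hG
  -- Linearity of `X` matters here: the collapse is applied to `X` on the last two legs of a general
  -- tensor in `A ⊗ Z ⊗ A`.
  have hGX : G ∘ₗ X = (LinearMap.mulRight k w).lTensor A ∘ₗ P.toSub.lTensor A ∘ₗ C.T :=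
    TensorProduct.ext' fun z b => hε z b w _ (hX z b)
  have e₁ : ∀ (g : A →ₗ[k] A ⊗[k] A) (x : Z ⊗[k] (A ⊗[k] Z)),
      ((TensorProduct.rid k A).toLinearMap ∘ₗ HY.counit.lTensor A ∘ₗ β.T).rTensor (A ⊗[k] Y)
        ((TensorProduct.assoc k Y A (A ⊗[k] Y)).symm
          (((TensorProduct.assoc k A A Y).toLinearMap ∘ₗ g.rTensor Y).lTensor Y
            (TensorProduct.map P.toSub (P.toSub.lTensor A) x))) =
      G.lTensor A (onFirstTwo (A ⊗[k] Z) C.T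
        (((TensorProduct.assoc k A A Z).toLinearMap ∘ₗ g.rTensor Z).lTensor Z x)) :=
      fun g x => by
    induction x using TensorProduct.induction_on with
    | zero => simp
    | add x y hx hy => simp only [map_add, hx, hy]
    | tmul z x =>
      induction x using TensorProduct.induction_on with
      | zero => simp
      | add x y hx hy => simp only [map_add, TensorProduct.tmul_add, hx, hy]
      | tmul b z' =>
        simp only [TensorProduct.map_tmul, LinearMap.lTensor_tmul, LinearMap.comp_apply,
          LinearMap.rTensor_tmul, LinearEquiv.coe_coe]
        generalize g b = u
        induction u using TensorProduct.induction_on with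
        | zero => simp
        | add x y hx hy =>
          simp only [map_add, TensorProduct.tmul_add, TensorProduct.add_tmul, hx, hy]
        | tmul r s =>
          simp only [TensorProduct.assoc_tmul, TensorProduct.assoc_symm_tmul,
            LinearMap.rTensor_tmul, onFirstTwo_tmul, LinearMap.comp_apply, hβ]
          generalize C.T (z ⊗ₜ r) = v
          induction v using TensorProduct.induction_on with
          | zero => simp
          | add x y hx hy => simp only [map_add, TensorProduct.add_tmul, hx, hy]
          | tmul d e => simp [hG, TensorProduct.smul_tmul]
  have e₂ : ∀ u : A ⊗[k] A, ((LinearMap.mulRight k w).lTensor A).lTensor A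
      (β.T.lTensor A (onFirstTwo A β.T (y ⊗ₜ[k] u))) =
      ((LinearMap.mulRight k w).lTensor A ∘ₗ P.toSub.lTensor A ∘ₗ C.T).lTensor A
        (onFirstTwo A C.T ((y : Z) ⊗ₜ[k] u)) := fun u => by
    induction u using TensorProduct.induction_on with
    | zero => simp
    | add x y hx hy => simp only [map_add, TensorProduct.tmul_add, hx, hy]
    | tmul r s =>
      have hy := hβ y r
      rw [toSub_coe] at hy
      rw [onFirstTwo_tmul, onFirstTwo_tmul, hy]
      generalize C.T ((y : Z) ⊗ₜ r) = v
      induction v using TensorProduct.induction_on with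
      | zero => simp
      | add x y hx hy => simp only [map_add, TensorProduct.add_tmul, hx, hy]
      | tmul d e => simp [hβ]
  rw [e₁, hC.onFirstTwo_cover hX, e₂, ← hGX, LinearMap.lTensor_comp_apply]

end AlgebraProjection

end Projections

/-! ### The induced partial comodule coalgebra. -/

theorem mainTheorem3 {k A Z : Type*} [Field k]
    [NonUnitalRing A] [Module k A] [IsScalarTower k A A] [SMulCommClass k A A]
    [NonUnitalRing Z] [Module k Z] [IsScalarTower k Z Z] [SMulCommClass k Z Z]
    (HA : RegularMultiplierHopfAlgebra k A) (HZ : RegularMultiplierHopfAlgebra k Z)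
    (C : CoactionMap k A Z) (hC : IsComoduleCoalgebra HA HZ C)
    (Y : NonUnitalSubalgebra k Z) (HY : RegularMultiplierHopfAlgebra k Y)
    (hY : IsMultiplierHopfSubalgebra HZ Y HY)
    (P : AlgebraProjection Y)
    (h₁ : P.IsComultiplicative HZ HY)
    (h₂ : ∀ (a : A) (z : Z),
      P.toSub.lTensor A (C.T (P.π z ⊗ₜ[k] a)) = P.toSub.lTensor A (C.T (z ⊗ₜ[k] a)))
    (h₃ : ∀ (a : A) (z : Z) (t : Y), HY.counit t = 1 →
      P.toSub.lTensor A (C.T (P.π z ⊗ₜ[k] a)) =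
        TensorProduct.lid k (A ⊗[k] Y)
          (TensorProduct.map (HY.counit ∘ₗ P.toSub) (P.toSub.lTensor A ∘ₗ C.Tat a)
            (HZ.ΔR₁ (z ⊗ₜ[k] (t : Z))))) :
    ∃ β : CoactionMap k A Y,
      (∀ (y : Y) (a : A), β.T (y ⊗ₜ[k] a) = P.toSub.lTensor A (C.T ((y : Z) ⊗ₜ[k] a))) ∧
      (∀ (a : A) (y : Y), β.Tbar (a ⊗ₜ[k] y) = P.toSub.lTensor A (C.Tbar (a ⊗ₜ[k] (y : Z)))) ∧
      IsPartialComoduleCoalgebra HA HY β := by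
  let β := P.coaction C HA.nondegenerate HZ.nondegenerate
  have hT : ∀ (y : Y) (a : A), β.T (y ⊗ₜ[k] a) = P.toSub.lTensor A (C.T ((y : Z) ⊗ₜ[k] a)) :=
    fun y a => rfl
  have hTbar : ∀ (a : A) (y : Y),
      β.Tbar (a ⊗ₜ[k] y) = P.toSub.lTensor A (C.Tbar (a ⊗ₜ[k] (y : Z))) := fun a y => rfl
  -- This is where (ii) extends the defining formula of `β` from `Y` to an intertwining property on
  -- all of `Z`.
  have hβ : ∀ z a, β.T (P.toSub z ⊗ₜ a) = P.toSub.lTensor A (C.T (z ⊗ₜ a)) :=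
    fun z a => (hT _ a).trans (h₂ a z)
  have hε : ∀ u : A ⊗[k] Z, TensorProduct.lid k Y (HA.counit.rTensor Y (P.toSub.lTensor A u)) =
      P.toSub (TensorProduct.lid k Z (HA.counit.rTensor Z u)) := fun u => by
    induction u using TensorProduct.induction_on with
    | zero => simp
    | add x y hx hy => simp only [map_add, hx, hy]
    | tmul r s => simp
  have hco := hC.isLeftComodule
  exact ⟨β, hT, hTbar,
    { counit_right := fun y a => by
        rw [hT, hε, hco.counit_right HZ.nondegenerate, map_smul, P.toSub_coe]
      counit_left := fun y a => by
        rw [hTbar, hε, hco.counit_left HZ.nondegenerate, map_smul, P.toSub_coe]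
      hasCovers := AlgebraProjection.hasCovers h₁ hβ hC.hasCovers
      isDeltaCompatible :=
        AlgebraProjection.isDeltaCompatible h₁ hβ hC.hasCovers hC.isDeltaCompatible
      partial_coassoc := AlgebraProjection.partial_coassoc hC h₁ hβ
        fun z a w x hx => AlgebraProjection.counit_cover h₂ h₃ hx }⟩
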